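/- Machines. A monotone machine is a deterministic Turing machine with a one-way read-only input tape, a one-way write-only output tape with alphabet $\{0,1\}$, and finitely many two-way work tapes with symbols $0$, $1$, blank; the input alphabet is $\{0,1\}$ unless said otherwise. In one time step it either works on its work tapes, or reads one input symbol, or prints one bit, or halts. A program $p\in\{0,1\}^*$ computes $x\in\{0,1\}^*$ on $T$, written $p\xrightarrow{T}x$, if, at the moment when the printing of $x$ is completed (the output is $x$ for the first time), $T$ has read all of $p$ but no more; $t(T,p,x)$ is the number of steps up to that moment. (In particular $p\xrightarrow{T}\epsilon$ iff $p=\epsilon$, where $\epsilon$ is the empty string.) Let $Km_T(x)=\min\{|p| : p\xrightarrow{T}x\}$, with $Km_T(x)=\infty$ and $2^{-Km_T(x)}=0$ if there is no such $p$. Codings. Let $\langle\cdot\rangle_{\{0,1\}^*}$ and $\langle\cdot\rangle_{\mathbb N}$ be prefix-free codings of $\{0,1\}^*$ and of $\mathbb N$ by binary strings (no code word is a prefix of the code word of a different element), both computable and decodable in polynomial time. That is, some machine, given the string (or the binary expansion of the number) followed by an end marker, prints the code word and halts, in time polynomial in the length of the string or expansion; and some machine, given the code word, reads it to its end, prints the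 string (or binary expansion) and halts, in time polynomial in the length of the code word. A function $f:\{0,1\}^*\to\mathbb R$ is finitely computable in polynomial time if there are a machine and a polynomial $q$ such that for every $x$ the machine, given input $\langle x\rangle_{\{0,1\}^*}$, prints $\langle m\rangle_{\mathbb N}\langle n\rangle_{\mathbb N}$ for some $m,n\in\mathbb N$ with $n>0$ and $f(x)=m/n$, and halts, within $q(|x|)$ steps. A semimeasure is a function $\nu:\{0,1\}^*\to[0,\infty)$ with $\nu(\epsilon)\le 1$ and $\nu(x)\ge\nu(x0)+\nu(x1)$ for all $x$. Lemma. Let $\nu$ be a semimeasure that is finitely computable in polynomial time. There is a monotone machine $T_\nu$ (with input alphabet $\{0,1\}$) such that: 1. $\displaystyle \nu(x)=\sum_{p\,\xrightarrow{T_\nu}\,x}2^{-|p|}$ for every nonempty $x\in\{0,1\}^*$, and also for $x=\epsilon$ if $\nu(\epsilon)=1$; 2. $2^{-Km_{T_\nu}(x)}\ge \nu(x)/4$ for every $x\in\{0,1\}^*$; 3. there are a polynomial $g$ with natural number coefficients and a constant $C\in\mathbb N$ such that, for every $x\in\{0,1\}^*$ and every shortest program $p$ for $x$ on $T_\nu$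 (that is, $p\xrightarrow{T_\nu}x$ and $|p|=Km_{T_\nu}(x)$), $t(T_\nu,p,x)\le g(|x|)-C\log_2\nu(x)$, where for $\nu(x)=0$ the term $C\log_2\nu(x)$ is omitted (this can only occur for $x=\epsilon$). -/

import Mathlib

/-- One instruction of a machine with input alphabet `ι`, state set `Q` and `k` work tapes. -/
inductive MonotoneTM.Action (ι Q : Type) (k : ℕ) : Type where
  /-- Rewrite the scanned work cells, move the work heads (`none`: stay), change state. -/
  | work (write : Fin k → Option Bool) (move : Fin k → Option Turing.Dir) (next : Q)
  /-- Read the next input symbol; the new state may depend on it. -/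
  | read (next : ι → Q)
  /-- Print one bit on the output tape, change state. -/
  | print (b : Bool) (next : Q)
  /-- Stop. -/
  | halt

/-- A monotone Turing machine: a one-way read-only input tape over the alphabet `ι`, a one-way
write-only binary output tape, and `k` two-way work tapes over `{0, 1, blank}` (`none` is the
blank), all blank at the start. The instruction is determined by the state and the scanned work
symbols, and every instruction takes one time step. -/
structure MonotoneTM (ι : Type) where
  State : Type
  finite_state : Finite State
  k : ℕ
  start : State
  δ : State → (Fin k → Option Bool) → MonotoneTM.Action ι State k

namespace MonotoneTM

variable {ι : Type}

/-- A configuration: state, work tapes, unread part of the given input, output so far. -/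
structure Cfg (T : MonotoneTM ι) where
  state : T.State
  tapes : Fin T.k → Turing.Tape (Option Bool)
  input : List ι
  output : List Bool

/-- The initial configuration on the input `p`. -/
def init (T : MonotoneTM ι) (p : List ι) : T.Cfg :=
  ⟨T.start, fun _ => default, p, []⟩

/-- The instruction to be executed in configuration `c`. -/
def action {T : MonotoneTM ι} (c : T.Cfg) : Action ι T.State T.k :=
  T.δ c.state (fun i => (c.tapes i).head)

/-- Move a head, or leave it where it is. -/
def moveHead (d : Option Turing.Dir) (τ : Turing.Tape (Option Bool)) :
    Turing.Tape (Option Bool) :=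
  match d with
  | none => τ
  | some d => τ.move d

/-- One time step. A machine that has halted, or that asks for a symbol beyond the given input,
stays where it is. -/
def step {T : MonotoneTM ι} (c : T.Cfg) : T.Cfg :=
  match action c with
  | .work w m q => { c with
      state := q
      tapes := fun i => moveHead (m i) ((c.tapes i).write (w i)) }
  | .read f =>
    match c.input with
    | [] => c
    | a :: rest => { c with state := f a, input := rest }
  | .print b q => { c with state := q, output := c.output ++ [b] }
  | .halt => c

/-- The configuration after `t` steps on input `p`. -/
def run (T : MonotoneTM ι) (p : List ι) (t : ℕ) : T.Cfg :=
  step^[t] (T.init p)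

/-- Given input `w`, after `t` steps `T` has halted, its output being `y`. -/
def HaltsAt (T : MonotoneTM ι) (w : List ι) (y : List Bool) (t : ℕ) : Prop :=
  action (T.run w t) = .halt ∧ (T.run w t).output = y

/-- Program `p` computes `x` on `T` in time exactly `t`: at step `t` the printing of `x` is
completed (the output is `x` for the first time), and at that moment `T` has read all of `p`
but no more. -/
def ComputesAt (T : MonotoneTM ι) (p : List ι) (x : List Bool) (t : ℕ) : Prop :=
  (T.run p t).output = x ∧ (∀ s < t, (T.run p s).output ≠ x) ∧ (T.run p t).input = []

/-- Program `p` computes `x` on `T`. -/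
def Computes (T : MonotoneTM ι) (p : List ι) (x : List Bool) : Prop :=
  ∃ t, T.ComputesAt p x t

/-- The length of the shortest program for `x` on `T` (`⊤` if there is none). -/
noncomputable def Km (T : MonotoneTM ι) (x : List Bool) : ℕ∞ :=
  ⨅ (p : List ι) (_ : T.Computes p x), (p.length : ℕ∞)

end MonotoneTM

/-- `2 ^ (-k)`, which is `0` for `k = ⊤`. -/
noncomputable def twoPowNeg (k : ℕ∞) : ℝ :=
  ENat.recTopCoe 0 (fun n : ℕ => (2 : ℝ) ^ (-(n : ℤ))) k

/-- A semimeasure on finite binary strings. -/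
structure IsSemimeasure (ν : List Bool → ℝ) : Prop where
  nonneg : ∀ x, 0 ≤ ν x
  nil_le_one : ν [] ≤ 1
  add_le : ∀ x, ν (x ++ [false]) + ν (x ++ [true]) ≤ ν x

/-- `code` is a prefix-free coding of the elements of `α`, computable and decodable in polynomial
time, where `raw` is the plain presentation of the elements of `α` as binary strings.
The encoder is given `raw a` followed by an end marker `none`. The decoder has to read the
code word `code a` to its end, without the help of an end marker. -/
structure IsPolyTimePrefixCode {α : Type} (raw code : α → List Bool) : Prop where
  prefix_free : ∀ a b, code a <+: code b → a = b
  computable : ∃ (E : MonotoneTM (Option Bool)) (q : Polynomial ℕ), ∀ a,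
    ∃ t ≤ q.eval (raw a).length, E.HaltsAt ((raw a).map some ++ [none]) (code a) t
  decodable : ∃ (D : MonotoneTM Bool) (q : Polynomial ℕ), ∀ a,
    ∃ t ≤ q.eval (code a).length, D.HaltsAt (code a) (raw a) t ∧ (D.run (code a) t).input = []

/-- `f` is finitely computable in polynomial time, with respect to the codings `codeStr` of
strings and `codeNat` of natural numbers: some machine, given the code of `x`, prints the codes
of some `m` and `n` with `f x = m / n`, and halts within polynomially many steps in `|x|`. -/
def FinitelyComputableInPolyTime (codeStr : List Bool → List Bool) (codeNat : ℕ → List Bool)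
    (f : List Bool → ℝ) : Prop :=
  ∃ (T : MonotoneTM Bool) (q : Polynomial ℕ), ∀ x : List Bool, ∃ m n : ℕ,
    0 < n ∧ f x = (m : ℝ) / (n : ℝ) ∧
      ∃ t ≤ q.eval x.length, T.HaltsAt (codeStr x) (codeNat m ++ codeNat n) t

/-! The machine is an arithmetic decoder. Every string x owns an interval of length ν(x): the
interval of x0 starts at the left end of that of x, the interval of x1 follows at once, and the
deficit of the semimeasure is a gap on the right. A program p stands for the dyadic interval of the
reals whose expansion begins with p. Having read p and printed y, the decoder prints b when the
interval of p lies in that of yb, and reads one more bit if neither child contains it.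

The strings whose interval contains that of p form a chain under the prefix order, so no wrong bit
is printed, and the programs for a nonempty x are exactly the minimal p whose interval lies in that
of x (`MonotoneTM.computes_iff_minFits`). Minimality makes these dyadic intervals disjoint; every
interior point of the interval of x lies in one of them, so their lengths add up to ν(x)
(`hasSum_minFits`). The midpoint lies in a fitting dyadic interval of length at least ν(x)/4, which
bounds the shortest program (`exists_minFits_le`).

For the time, ν(x) = m/n where n has polynomially many bits. A positive ν(x) is therefore at least 2
to the minus a polynomial in |x|, so shortest programs have polynomial length. Producing x takes at
most |p| + |x| rounds of polynomial cost each (`MonotoneTM.time_le`), hence time polynomial in |x|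
alone, and C = 0 suffices.

It remains to realize a round by a machine. Stack programs serve as the intermediate model: their
polynomial-time functions are closed under composition and bounded recursion on notation
(`PolyTime.comp`, `PolyTime.recursion`), which gives binary arithmetic and the inclusion test by
cross multiplication. The given machines for ν and the codings become stack programs
(`PolyTime.of_haltsAt`, `PolyTime.of_haltsAt_rest`), and the program for the next bit becomes a
monotone machine again (`MonotoneTM.exists_decodes`). Programs and outputs are kept in reverse, so
that reading or printing a bit is a push, and the top of the program is its least significant binary
digit. -/

/-! ### Programs acting on finitely many stacks of bits -/

/-- The contents of a family of stacks. -/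
abbrev Regs := ℕ → List Bool

/-- Instructions acting on stacks of bits. -/
inductive StackInstr (S : Type) : Type where
  | pop (i : ℕ) (next : Option Bool → S)
  | push (i : ℕ) (b : Bool) (next : S)
  | skip (next : S)

namespace StackInstr

variable {S S' : Type}

/-- The effect of an instruction. -/
def exec : StackInstr S → Regs → S × Regs
  | pop i f, s => (f (s i).head?, Function.update s i (s i).tail)
  | push i b q, s => (q, Function.update s i (b :: s i))
  | skip q, s => (q, s)

/-- Relabel the successor states. -/
def map (f : S → S') : StackInstr S → StackInstr S'
  | pop i g => pop i (f ∘ g)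
  | push i b q => push i b (f q)
  | skip q => skip (f q)

/-- Rename the stacks. -/
def rename (e : ℕ → ℕ) : StackInstr S → StackInstr S
  | pop i g => pop (e i) g
  | push i b q => push (e i) b q
  | skip q => skip q

/-- The stack used by an instruction. -/
def index : StackInstr S → ℕ
  | pop i _ => i
  | push i _ _ => i
  | skip _ => 0

theorem exec_map (f : S → S') (c : StackInstr S) (s : Regs) :
    (c.map f).exec s = (f (c.exec s).1, (c.exec s).2) := by
  cases c <;> rfl

theorem exec_rename {e : ℕ → ℕ} (he : e.Injective) (c : StackInstr S) (s : Regs) :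
    ((c.rename e).exec s).1 = (c.exec (s ∘ e)).1 ∧
      ((c.rename e).exec s).2 ∘ e = (c.exec (s ∘ e)).2 ∧
      ∀ i, i ∉ Set.range e → ((c.rename e).exec s).2 i = s i := by
  cases c with
  | pop i g =>
    refine ⟨rfl, ?_, ?_⟩
    · simp only [rename, exec, Function.comp_apply]
      rw [Function.update_comp_eq_of_injective _ he]
    · intro j hj
      simp only [rename, exec]
      rw [Function.update_of_ne]
      rintro rfl
      exact hj ⟨_, rfl⟩
  | push i b q =>
    refine ⟨rfl, ?_, ?_⟩
    · simp only [rename, exec, Function.comp_apply]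
      rw [Function.update_comp_eq_of_injective _ he]
    · intro j hj
      simp only [rename, exec]
      rw [Function.update_of_ne]
      rintro rfl
      exact hj ⟨_, rfl⟩
  | skip q => exact ⟨rfl, rfl, fun _ _ => rfl⟩

theorem length_exec_le (c : StackInstr S) (s : Regs) (i : ℕ) :
    ((c.exec s).2 i).length ≤ (s i).length + 1 := by
  cases c with
  | pop j g =>
    simp only [exec, Function.update_apply]
    split_ifs with h
    · subst h; simp; omega
    · omega
  | push j b q =>
    simp only [exec, Function.update_apply]
    split_ifs with h
    · subst h; simp
    · omega
  | skip q => simp [exec]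

end StackInstr

/-- A program acting on stacks, which may terminate with a result in `β`. -/
structure StackProg (β : Type) where
  State : Type
  finite_state : Finite State
  start : State
  code : State → StackInstr (State ⊕ β)

namespace StackProg

variable {α β γ : Type}

/-- Started in state `q` with stacks `s`, the program terminates after `t` steps with the result
`b` and stacks `s'`. -/
inductive Run (F : StackProg β) : F.State → Regs → β → Regs → ℕ → Prop
  | exit {q s b s'} : (F.code q).exec s = (Sum.inr b, s') → Run F q s b s' 1
  | step {q s q' s' b s'' t} : (F.code q).exec s = (Sum.inl q', s') → Run F q' s' b s'' t →
      Run F q s b s'' (t + 1)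

/-- An instruction pushes at most one bit. This turns time bounds into bounds on the length of
results. -/
theorem Run.length_le {F : StackProg β} {q s b s' t} (h : F.Run q s b s' t) (i : ℕ) :
    (s' i).length ≤ (s i).length + t := by
  induction h with
  | @exit q s b s' h =>
    have := (F.code q).length_exec_le s i
    rw [h] at this
    exact this
  | @step q s q' s' b s'' t h _ ih =>
    have := (F.code q).length_exec_le s i
    rw [h] at this
    simp only at this
    omega

/-- Run `F`, then the program `G b` that depends on the result `b`. -/
def bind [Finite β] (F : StackProg β) (G : β → StackProg γ) : StackProg γ where
  State := F.State ⊕ (Σ b, (G b).State)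
  finite_state := by
    have := F.finite_state
    have := fun b => (G b).finite_state
    infer_instance
  start := Sum.inl F.start
  code
    | Sum.inl q => (F.code q).map
        (Sum.elim (fun q' => Sum.inl (Sum.inl q')) (fun b => Sum.inl (Sum.inr ⟨b, (G b).start⟩)))
    | Sum.inr ⟨b, q⟩ => ((G b).code q).map
        (Sum.elim (fun q' => Sum.inl (Sum.inr ⟨b, q'⟩)) Sum.inr)

theorem run_bind_right [Finite β] (F : StackProg β) (G : β → StackProg γ) {b q s c s' t}
    (h : (G b).Run q s c s' t) : (F.bind G).Run (Sum.inr ⟨b, q⟩) s c s' t := by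
  induction h with
  | exit h => exact .exit (by simp [bind, StackInstr.exec_map, h])
  | step h _ ih => exact .step (by simp only [bind, StackInstr.exec_map, h]; rfl) ih

/-- The exit instruction of `F` is itself the jump to the start of `G b`, so the times add without
overhead. -/
theorem run_bind [Finite β] {F : StackProg β} {G : β → StackProg γ} {q s b s' t c s'' t'}
    (h : F.Run q s b s' t) (h' : (G b).Run (G b).start s' c s'' t') :
    (F.bind G).Run (Sum.inl q) s c s'' (t + t') := by
  induction h with
  | exit h =>
    rw [add_comm]
    exact .step (by simp only [bind, StackInstr.exec_map, h]; rfl) (run_bind_right F G h')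
  | step h _ ih =>
    rw [add_right_comm]
    exact .step (by simp only [bind, StackInstr.exec_map, h]; rfl) (ih h')

/-- Repeat a program until it returns a result in `β`. -/
def iter [Finite α] (G : α → StackProg (α ⊕ β)) (a : α) : StackProg β where
  State := Σ a, (G a).State
  finite_state := by
    have := fun a => (G a).finite_state
    infer_instance
  start := ⟨a, (G a).start⟩
  code q := ((G q.1).code q.2).map
    (Sum.elim (fun q' => Sum.inl ⟨q.1, q'⟩)
      (Sum.elim (fun a' => Sum.inl ⟨a', (G a').start⟩) Sum.inr))

/-- The stepwise closure of a relation between stacks. -/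
inductive IterRel (R : α → Regs → α ⊕ β → Regs → ℕ → Prop) : α → Regs → β → Regs → ℕ → Prop
  | done {a s b s' t} : R a s (Sum.inr b) s' t → IterRel R a s b s' t
  | next {a s a' s' t b s'' t'} : R a s (Sum.inl a') s' t → IterRel R a' s' b s'' t' →
      IterRel R a s b s'' (t + t')

theorem run_iter_exit [Finite α] (G : α → StackProg (α ⊕ β)) (a₀ : α) {a q s b s' t}
    (h : (G a).Run q s (Sum.inr b) s' t) : (iter G a₀).Run ⟨a, q⟩ s b s' t := by
  generalize hb : (Sum.inr b : α ⊕ β) = b' at h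
  induction h with
  | exit h => subst hb; exact .exit (by simp [iter, StackInstr.exec_map, h])
  | step h _ ih => exact .step (by simp only [iter, StackInstr.exec_map, h]; rfl) (ih hb)

theorem run_iter_next [Finite α] (G : α → StackProg (α ⊕ β)) (a₀ : α) {a q s a' s' t b s'' t'}
    (h : (G a).Run q s (Sum.inl a') s' t) (h' : (iter G a₀).Run ⟨a', (G a').start⟩ s' b s'' t') :
    (iter G a₀).Run ⟨a, q⟩ s b s'' (t + t') := by
  generalize hb : (Sum.inl a' : α ⊕ β) = b' at h
  induction h with
  | exit h =>
    subst hb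
    rw [add_comm]
    exact .step (by simp only [iter, StackInstr.exec_map, h]; rfl) h'
  | step h _ ih =>
    rw [add_right_comm]
    exact .step (by simp only [iter, StackInstr.exec_map, h]; rfl) (ih h' hb)

/-- Rename the stacks used by a program. -/
def rename (e : ℕ → ℕ) (F : StackProg β) : StackProg β where
  State := F.State
  finite_state := F.finite_state
  start := F.start
  code q := (F.code q).rename e

theorem run_rename {e : ℕ → ℕ} (he : e.Injective) {F : StackProg β} {q r b r' t}
    (h : F.Run q r b r' t) : ∀ s : Regs, s ∘ e = r → ∃ s', (F.rename e).Run q s b s' t ∧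
      s' ∘ e = r' ∧ ∀ i, i ∉ Set.range e → s' i = s i := by
  induction h with
  | @exit q r b r' h =>
    rintro s rfl
    obtain ⟨h1, h2, h3⟩ := StackInstr.exec_rename he (F.code q) s
    rw [h] at h1 h2
    exact ⟨(((F.code q).rename e).exec s).2, .exit (Prod.ext h1 rfl), h2, h3⟩
  | @step q r q' r' b r'' t h _ ih =>
    rintro s rfl
    obtain ⟨h1, h2, h3⟩ := StackInstr.exec_rename he (F.code q) s
    rw [h] at h1 h2
    obtain ⟨s', hr, hs, hi⟩ := ih _ h2
    exact ⟨s', .step (s' := (((F.code q).rename e).exec s).2) (Prod.ext h1 rfl) hr, hs,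
      fun i hi' => (hi i hi').trans (h3 i hi')⟩

/-! ### Specifications realized by stack programs -/

/-- Some program realizes the relation `R s b s' t` between initial stacks, result and final
stacks, within `t` steps. -/
def Impl (R : Regs → β → Regs → ℕ → Prop) : Prop :=
  ∃ F : StackProg β, ∀ s b s' t, R s b s' t → ∃ t' ≤ t, F.Run F.start s b s' t'

namespace Impl

/-- A relation here is a promise about certain initial stacks, preconditions included. A smaller
relation, or one with larger times, promises less; hence the inclusion goes from `R'` to `R`. -/
theorem mono {R R' : Regs → β → Regs → ℕ → Prop} (h : Impl R)
    (hR : ∀ s b s' t, R' s b s' t → ∃ t' ≤ t, R s b s' t') : Impl R' := by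
  obtain ⟨F, hF⟩ := h
  refine ⟨F, fun s b s' t hr => ?_⟩
  obtain ⟨t', ht, hr'⟩ := hR _ _ _ _ hr
  obtain ⟨t'', ht', hr''⟩ := hF _ _ _ _ hr'
  exact ⟨t'', ht'.trans ht, hr''⟩

theorem pure (b : β) : Impl fun s b' s' t => b' = b ∧ s' = s ∧ t = 1 :=
  ⟨⟨Unit, inferInstance, (), fun _ => .skip (Sum.inr b)⟩, by
    rintro s _ _ _ ⟨rfl, rfl, rfl⟩
    exact ⟨1, le_rfl, .exit rfl⟩⟩

theorem pop (i : ℕ) : Impl fun s b s' t =>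
    b = (s i).head? ∧ s' = Function.update s i (s i).tail ∧ t = 1 :=
  ⟨⟨Unit, inferInstance, (), fun _ => .pop i Sum.inr⟩, by
    rintro s _ _ _ ⟨rfl, rfl, rfl⟩
    exact ⟨1, le_rfl, .exit rfl⟩⟩

theorem push (i : ℕ) (c : Bool) : Impl fun s (_ : Unit) s' t =>
    s' = Function.update s i (c :: s i) ∧ t = 1 :=
  ⟨⟨Unit, inferInstance, (), fun _ => .push i c (Sum.inr ())⟩, by
    rintro s _ _ _ ⟨rfl, rfl⟩
    exact ⟨1, le_rfl, .exit rfl⟩⟩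

theorem bind [Finite β] {R : Regs → β → Regs → ℕ → Prop} {R' : β → Regs → γ → Regs → ℕ → Prop}
    (h : Impl R) (h' : ∀ b, Impl (R' b)) :
    Impl fun s c s'' t => ∃ b s' t₁ t₂, R s b s' t₁ ∧ R' b s' c s'' t₂ ∧ t = t₁ + t₂ := by
  obtain ⟨F, hF⟩ := h
  choose G hG using h'
  refine ⟨F.bind G, ?_⟩
  rintro s c s'' _ ⟨b, s', t₁, t₂, h₁, h₂, rfl⟩
  obtain ⟨t₁', ht₁, hr₁⟩ := hF _ _ _ _ h₁
  obtain ⟨t₂', ht₂, hr₂⟩ := hG _ _ _ _ _ h₂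
  exact ⟨t₁' + t₂', by omega, run_bind hr₁ hr₂⟩

theorem seq {R : Regs → Unit → Regs → ℕ → Prop} {R' : Regs → γ → Regs → ℕ → Prop}
    (h : Impl R) (h' : Impl R') :
    Impl fun s c s'' t => ∃ s' t₁ t₂, R s () s' t₁ ∧ R' s' c s'' t₂ ∧ t = t₁ + t₂ :=
  (h.bind fun _ => h').mono fun _ _ _ t ⟨s', t₁, t₂, h₁, h₂, e⟩ =>
    ⟨t, le_rfl, (), s', t₁, t₂, h₁, h₂, e⟩

theorem iter [Finite α] {R : α → Regs → α ⊕ β → Regs → ℕ → Prop} (h : ∀ a, Impl (R a)) (a : α) :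
    Impl (IterRel R a) := by
  choose G hG using h
  refine ⟨StackProg.iter G a, fun s b s' t hr => ?_⟩
  suffices ∀ a₀, ∃ t' ≤ t, (StackProg.iter G a₀).Run ⟨a, (G a).start⟩ s b s' t' from this a
  intro a₀
  induction hr with
  | done h =>
    obtain ⟨t', ht, hr⟩ := hG _ _ _ _ _ h
    exact ⟨t', ht, run_iter_exit G a₀ hr⟩
  | next h _ ih =>
    obtain ⟨t', ht, hr⟩ := hG _ _ _ _ _ h
    obtain ⟨t'', ht', hr'⟩ := ih
    exact ⟨t' + t'', by omega, run_iter_next G a₀ hr hr'⟩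

theorem rename {R : Regs → β → Regs → ℕ → Prop} (h : Impl R) {e : ℕ → ℕ} (he : e.Injective) :
    Impl fun s b s' t => R (s ∘ e) b (s' ∘ e) t ∧ ∀ i, i ∉ Set.range e → s' i = s i := by
  obtain ⟨F, hF⟩ := h
  refine ⟨F.rename e, ?_⟩
  rintro s b s' t ⟨hr, hi⟩
  obtain ⟨t', ht, hr⟩ := hF _ _ _ _ hr
  obtain ⟨s'', hr', hs, hi'⟩ := run_rename he hr s rfl
  obtain rfl : s'' = s' := by
    funext i
    by_cases h : i ∈ Set.range e
    · obtain ⟨j, rfl⟩ := h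
      exact congrFun hs j
    · rw [hi i h, hi' i h]
  exact ⟨t', ht, hr'⟩

end Impl

end StackProg

theorem Polynomial.eval_mono_nat (P : Polynomial ℕ) : Monotone fun n => P.eval n := by
  intro a b h
  simp only [Polynomial.eval_eq_sum_range]
  gcongr

/-! ### Loops over the bits of a stack: clearing, moving, copying -/

namespace StackProg

/-- The effect of a loop that pops the bits from stack `i` and executes `R b` for every bit `b`. -/
inductive ForEachRel (i : ℕ) (R : Bool → Regs → Unit → Regs → ℕ → Prop) :
    Regs → Unit → Regs → ℕ → Prop
  | nil {s} : s i = [] → ForEachRel i R s () s 2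
  | cons {s b l s' t s'' t'} : s i = b :: l → R b (Function.update s i l) () s' t →
      ForEachRel i R s' () s'' t' → ForEachRel i R s () s'' (t + t' + 2)

namespace Impl

theorem forEach (i : ℕ) {R : Bool → Regs → Unit → Regs → ℕ → Prop} (h : ∀ b, Impl (R b)) :
    Impl (ForEachRel i R) := by
  have body : Impl fun s (c : Unit ⊕ Unit) s' t =>
      (s i = [] ∧ c = Sum.inr () ∧ s' = s ∧ t = 2) ∨
      ∃ b l t', s i = b :: l ∧ R b (Function.update s i l) () s' t' ∧ c = Sum.inl () ∧
        t = t' + 2 := by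
    have : ∀ o : Option Bool, Impl fun s (c : Unit ⊕ Unit) s' t =>
        (o = none ∧ c = Sum.inr () ∧ s' = s ∧ t = 1) ∨
        ∃ b t', o = some b ∧ R b s () s' t' ∧ c = Sum.inl () ∧ t = t' + 1 := by
      rintro (_ | b)
      · refine (Impl.pure (Sum.inr ())).mono ?_
        rintro s b s' t (⟨-, rfl, rfl, rfl⟩ | ⟨_, _, h, _⟩)
        · exact ⟨1, le_rfl, rfl, rfl, rfl⟩
        · cases h
      · refine ((h b).seq (Impl.pure (Sum.inl ()))).mono ?_
        rintro s c s' t (⟨h, _⟩ | ⟨_, t', h, hR, rfl, rfl⟩)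
        · cases h
        · cases h
          exact ⟨t' + 1, le_rfl, s', t', 1, hR, ⟨rfl, rfl, rfl⟩, rfl⟩
    refine ((Impl.pop i).bind this).mono ?_
    rintro s c s' t (⟨h, rfl, rfl, rfl⟩ | ⟨b, l, t', h, hR, rfl, rfl⟩)
    · refine ⟨2, le_rfl, none, s', 1, 1, ⟨by simp [h], ?_, rfl⟩, Or.inl ⟨rfl, rfl, rfl, rfl⟩, rfl⟩
      simp [h]
    · exact ⟨t' + 2, le_rfl, some b, Function.update s i l, 1, t' + 1, ⟨by simp [h], by simp [h], rfl⟩,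
        Or.inr ⟨b, t', rfl, hR, rfl, rfl⟩, by omega⟩
  refine (Impl.iter (fun _ : Unit => body) ()).mono ?_
  intro s c s' t hr
  refine ⟨t, le_rfl, ?_⟩
  induction hr with
  | nil h => exact .done (Or.inl ⟨h, rfl, rfl, rfl⟩)
  | @cons s b l s' t s'' t' h hR _ ih =>
    rw [add_right_comm]
    exact .next (Or.inr ⟨b, l, t, h, hR, rfl, rfl⟩) ih

theorem clear (i : ℕ) : Impl fun s (_ : Unit) s' t =>
    s' = Function.update s i [] ∧ t = 3 * (s i).length + 2 := by
  refine (Impl.forEach i fun _ => Impl.pure ()).mono ?_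
  rintro s ⟨⟩ s' t ⟨rfl, rfl⟩
  refine ⟨_, le_rfl, ?_⟩
  generalize hl : s i = l
  induction l generalizing s with
  | nil =>
    rw [← hl, Function.update_eq_self]
    simp only [hl, List.length_nil]
    exact .nil hl
  | cons b l ih =>
    have := ih (Function.update s i l) (by simp)
    rw [Function.update_idem] at this
    have := ForEachRel.cons (t := 1) (R := fun _ s b s' t => b = () ∧ s' = s ∧ t = 1) hl
      ⟨rfl, rfl, rfl⟩ this
    convert this using 1
    simp; omega

theorem moveRev {i j : ℕ} (hij : i ≠ j) : Impl fun s (_ : Unit) s' t =>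
    s' = Function.update (Function.update s i []) j ((s i).reverse ++ s j) ∧
      t = 3 * (s i).length + 2 := by
  refine (Impl.forEach i fun b => Impl.push j b).mono ?_
  rintro s ⟨⟩ s' t ⟨rfl, rfl⟩
  refine ⟨_, le_rfl, ?_⟩
  generalize hl : s i = l
  induction l generalizing s with
  | nil =>
    have : Function.update (Function.update s i []) j ([].reverse ++ s j) = s := by
      funext k
      simp only [Function.update_apply]
      split_ifs with h1 h2
      · subst h1; simp
      · subst h2; exact hl.symm
      · rfl
    rw [this]
    exact .nil hl
  | cons b l ih =>
    have := ih (Function.update (Function.update s i l) j (b :: s j)) (by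
      simp [Function.update_of_ne hij])
    have := ForEachRel.cons (t := 1)
      (R := fun c s (_ : Unit) s' t => s' = Function.update s j (c :: s j) ∧ t = 1) hl
      ⟨by rw [Function.update_of_ne hij.symm], rfl⟩ this
    convert this using 1
    · funext k
      simp only [Function.update_apply]
      split_ifs <;> simp_all
    · simp; omega

/-- Stack `i` is poured into the scratch stack `k`, then `k` is poured into `i` and `j` at once; the
two reversals cancel. The passes cost 3 and 4 steps per bit. -/
theorem copy {i j k : ℕ} (hij : i ≠ j) (hik : i ≠ k) (hjk : j ≠ k) :
    Impl fun s (_ : Unit) s' t => s j = [] ∧ s k = [] ∧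
      s' = Function.update s j (s i) ∧ t = 7 * (s i).length + 4 := by
  have h2 : Impl fun s (_ : Unit) s' t => s' = Function.update (Function.update
      (Function.update s k []) i ((s k).reverse ++ s i)) j ((s k).reverse ++ s j) ∧
      t = 4 * (s k).length + 2 := by
    refine (Impl.forEach k fun b => (Impl.push i b).seq (Impl.push j b)).mono ?_
    rintro s ⟨⟩ s' t ⟨rfl, rfl⟩
    refine ⟨_, le_rfl, ?_⟩
    generalize hl : s k = l
    induction l generalizing s with
    | nil =>
      convert ForEachRel.nil hl using 1
      · funext m
        simp only [Function.update_apply]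
        split_ifs <;> simp_all
      · simp
    | cons b l ih =>
      have := ih (Function.update (Function.update (Function.update s k l) i (b :: s i))
        j (b :: s j)) (by simp [Function.update_of_ne hik.symm, Function.update_of_ne hjk.symm])
      have := ForEachRel.cons (t := 2) hl ⟨_, 1, 1, ⟨rfl, rfl⟩, ⟨rfl, rfl⟩, rfl⟩
        (R := fun c s (_ : Unit) s'' t => ∃ s' t₁ t₂,
          (s' = Function.update s i (c :: s i) ∧ t₁ = 1) ∧
          (s'' = Function.update s' j (c :: s' j) ∧ t₂ = 1) ∧ t = t₁ + t₂)
        (by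
          convert this using 2
          all_goals simp [Function.update_of_ne hik, Function.update_of_ne hij.symm,
            Function.update_of_ne hjk])
      convert this using 1
      · funext m
        simp only [Function.update_apply]
        split_ifs <;> simp_all
      · simp; omega
  refine ((Impl.moveRev hik).seq h2).mono ?_
  rintro s ⟨⟩ s' t ⟨hj, hk, rfl, rfl⟩
  refine ⟨_, le_rfl, _, _, _, ⟨rfl, rfl⟩, ⟨?_, rfl⟩, ?_⟩
  · funext m
    simp only [Function.update_apply]
    split_ifs <;> simp_all
  · simp [hk]; omega

theorem clearAll (n : ℕ) : Impl fun s (_ : Unit) s' t =>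
    s' = (fun i => if i < n then [] else s i) ∧
      t = 3 * ∑ i ∈ Finset.range n, (s i).length + 2 * n + 1 := by
  induction n with
  | zero =>
    refine (Impl.pure ()).mono ?_
    rintro s ⟨⟩ s' t ⟨rfl, rfl⟩
    exact ⟨1, by simp, rfl, by simp, rfl⟩
  | succ n ih =>
    refine (ih.seq (Impl.clear n)).mono ?_
    rintro s ⟨⟩ s' t ⟨rfl, rfl⟩
    refine ⟨_, le_rfl, _, _, _, ⟨rfl, rfl⟩, ⟨?_, rfl⟩, ?_⟩
    · funext m
      simp only [Function.update_apply]
      split_ifs <;> first | rfl | omega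
    · simp [Finset.sum_range_succ]; omega

end Impl

end StackProg

/-! ### Polynomial-time functions of strings and their closure properties -/

/-- The total length of a tuple of strings. -/
def totalLength {n : ℕ} (v : Fin n → List Bool) : ℕ := ∑ i, (v i).length

theorem length_le_totalLength {n : ℕ} (v : Fin n → List Bool) (i : Fin n) :
    (v i).length ≤ totalLength v :=
  Finset.single_le_sum (f := fun i => (v i).length) (fun _ _ => Nat.zero_le _) (Finset.mem_univ i)

open StackProg

/-- A function on tuples of strings is computable in polynomial time: a program finds the
arguments in the first `n` stacks, and the result is placed in the next one. -/
def PolyTime {n : ℕ} (f : (Fin n → List Bool) → List Bool) : Prop :=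
  ∃ P : Polynomial ℕ, Impl fun s (_ : Unit) s' t => (∀ i ≥ n, s i = []) ∧
    s' = Function.update s n (f fun i => s i) ∧ t = P.eval (totalLength fun i : Fin n => s i)

/-- As `PolyTime`, but the arguments are erased, and the result is placed in the first stack. -/
def PolyTimeErasing {n : ℕ} (f : (Fin n → List Bool) → List Bool) : Prop :=
  ∃ P : Polynomial ℕ, Impl fun s (_ : Unit) s' t => (∀ i ≥ n, s i = []) ∧
    s' = Function.update (fun _ => []) 0 (f fun i => s i) ∧
      t = P.eval (totalLength fun i : Fin n => s i)

namespace PolyTime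

variable {n m : ℕ}

/-- The result stack starts empty, so the running time bounds the length of the result. -/
theorem exists_length_le {f : (Fin n → List Bool) → List Bool} (h : PolyTime f) :
    ∃ Q : Polynomial ℕ, ∀ v, (f v).length ≤ Q.eval (totalLength v) := by
  obtain ⟨P, F, hF⟩ := h
  refine ⟨P, fun v => ?_⟩
  set s : Regs := fun i => if h : i < n then v ⟨i, h⟩ else [] with hs
  have hv : (fun i : Fin n => s i) = v := by
    funext i
    simp [hs]
  obtain ⟨t', ht, hr⟩ := hF s () _ _ ⟨fun i hi => by simp [hs, Nat.not_lt.2 hi], rfl, rfl⟩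
  have := hr.length_le n
  rw [hv] at this ht
  simp [hs] at this
  omega

/-- Shifting the result and scratch stacks up to `k` and beyond leaves the stacks from `n` to `k -
1` free to hold other data during the computation. -/
theorem exists_impl {f : (Fin n → List Bool) → List Bool} (h : PolyTime f) :
    ∃ P : Polynomial ℕ, ∀ k ≥ n, Impl fun s (_ : Unit) s' t => (∀ i ≥ k, s i = []) ∧
      s' = Function.update s k (f fun i => s i) ∧
        t = P.eval (totalLength fun i : Fin n => s i) := by
  obtain ⟨P, h⟩ := h
  refine ⟨P, fun k hk => ?_⟩
  set e : ℕ → ℕ := fun i => if i < n then i else i - n + k with he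
  have hinj : e.Injective := by
    intro i j hij
    simp only [he] at hij
    split_ifs at hij <;> omega
  have hen : e n = k := by simp [he]
  have hlt : ∀ i : Fin n, e i = i := fun i => by simp [he]
  refine (h.rename hinj).mono ?_
  rintro s ⟨⟩ s' t ⟨hs, rfl, rfl⟩
  refine ⟨_, le_rfl, ⟨fun i hi => hs _ (by simp only [he]; split_ifs <;> omega), ?_, ?_⟩, ?_⟩
  · rw [← hen, Function.update_comp_eq_of_injective _ hinj]
    simp [hlt]
  · simp [hlt]
  · intro i hi
    rw [Function.update_of_ne]
    rintro rfl
    exact hi ⟨n, hen⟩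

theorem erasing {f : (Fin n → List Bool) → List Bool} (h : PolyTime f) : PolyTimeErasing f := by
  obtain ⟨Q, hQ⟩ := h.exists_length_le
  obtain ⟨P, h⟩ := h
  refine ⟨P + (3 * Polynomial.X + Polynomial.C (2 * n + 1)) + (6 * Q + 4), ?_⟩
  -- Each move reverses the result; passing through stack `n + 1` restores its order.
  refine (h.seq ((Impl.clearAll n).seq ((Impl.moveRev (Nat.succ_ne_self n).symm).seq
    (Impl.moveRev (Nat.succ_ne_zero n))))).mono ?_
  rintro s ⟨⟩ s' t ⟨hs, rfl, rfl⟩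
  refine ⟨_, ?_, _, _, _, ⟨hs, rfl, rfl⟩, ⟨_, _, _, ⟨rfl, rfl⟩, ⟨_, _, _, ⟨rfl, rfl⟩, ⟨?_, rfl⟩, rfl⟩,
    rfl⟩, rfl⟩
  · have h1 : ∑ i ∈ Finset.range n, (Function.update s n (f fun i => s i) i).length =
        totalLength fun i : Fin n => s i := by
      rw [totalLength, Fin.sum_univ_eq_sum_range (fun i => (s i).length)]
      refine Finset.sum_congr rfl fun i hi => ?_
      rw [Function.update_of_ne (Finset.mem_range.1 hi).ne]
    rw [h1]
    have := hQ fun i => s i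
    simp [hs (n + 1) (by omega)]
    omega
  · funext i
    have h1 := hs (n + 1) (by omega)
    simp only [Function.update_apply]
    split_ifs <;> first | omega | simp_all

theorem proj (i : Fin n) : PolyTime fun v => v i := by
  refine ⟨7 * Polynomial.X + 4, ?_⟩
  refine (Impl.copy (i := i) (j := n) (k := n + 1) (by omega) (by omega) (by omega)).mono ?_
  rintro s ⟨⟩ s' t ⟨hs, rfl, rfl⟩
  refine ⟨_, ?_, hs _ le_rfl, hs _ (by omega), rfl, rfl⟩
  have := length_le_totalLength (fun i : Fin n => s i) i
  simp
  omega

theorem exists_impl_tuple {g : Fin m → (Fin n → List Bool) → List Bool}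
    (hg : ∀ i, PolyTime (g i)) : ∀ j ≤ m, ∃ P : Polynomial ℕ, Impl fun s (_ : Unit) s' t =>
      (∀ i ≥ n, s i = []) ∧ (s' = fun i => if i < n then s i else
        if h : i - n < m then if i - n < j then g ⟨i - n, h⟩ fun i => s i else [] else []) ∧
      t = P.eval (totalLength fun i : Fin n => s i) := by
  intro j
  induction j with
  | zero =>
    refine fun _ => ⟨1, (Impl.pure ()).mono ?_⟩
    rintro s ⟨⟩ s' t ⟨hs, rfl, rfl⟩
    refine ⟨1, by simp, rfl, ?_, rfl⟩
    funext i
    split_ifs <;> first | rfl | omega | exact (hs i (by omega)).symm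
  | succ j ih =>
    intro hj
    obtain ⟨P, hP⟩ := ih (by omega)
    obtain ⟨P', hP'⟩ := (hg ⟨j, hj⟩).exists_impl
    refine ⟨P + P', (hP.seq (hP' (n + j) (by omega))).mono ?_⟩
    rintro s ⟨⟩ s' t ⟨hs, rfl, rfl⟩
    refine ⟨_, le_rfl, _, _, _, ⟨hs, rfl, rfl⟩, ⟨fun i hi => ?_, ?_, rfl⟩, ?_⟩
    · split_ifs <;> first | rfl | omega
    · funext i
      rcases eq_or_ne i (n + j) with rfl | hi
      · simp [show j < m from hj]
      · rw [Function.update_of_ne hi]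
        split_ifs <;> first | rfl | omega
    · simp

/-- The values of the `g i` are laid out from stack `n` on, and `f` runs there with all its stacks
shifted by `n`. Since `f` erases its arguments, only its result remains, in stack `n`. -/
theorem comp_erasing {f : (Fin m → List Bool) → List Bool}
    {g : Fin m → (Fin n → List Bool) → List Bool} (hf : PolyTimeErasing f)
    (hg : ∀ i, PolyTime (g i)) : PolyTime fun v => f fun i => g i v := by
  choose Q hQ using fun i => (hg i).exists_length_le
  obtain ⟨P, hP⟩ := exists_impl_tuple hg m le_rfl
  obtain ⟨P', hP'⟩ := hf
  refine ⟨P + P'.comp (∑ i, Q i), ?_⟩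
  refine (hP.seq (hP'.rename (add_right_injective n))).mono ?_
  rintro s ⟨⟩ s' t ⟨hs, rfl, rfl⟩
  refine ⟨_, ?_, _, _, _, ⟨hs, rfl, rfl⟩, ⟨⟨fun i hi => ?_, ?_, rfl⟩, fun i hi => ?_⟩, rfl⟩
  · simp only [Polynomial.eval_add, Polynomial.eval_comp]
    gcongr
    apply P'.eval_mono_nat
    simp only [totalLength, Function.comp_apply, Polynomial.eval_finsetSum]
    refine Finset.sum_le_sum fun i _ => ?_
    simpa [totalLength] using hQ i fun i => s i
  · simp [Nat.not_lt.2 hi]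
  · funext i
    rcases eq_or_ne i 0 with rfl | hi
    · simp
    · simp [hi, hs (n + i) (by omega)]
  · have hi' : i < n := by
      by_contra h
      exact hi ⟨i - n, by simp; omega⟩
    simp [hi', hi'.ne]

theorem comp {f : (Fin m → List Bool) → List Bool} {g : Fin m → (Fin n → List Bool) → List Bool}
    (hf : PolyTime f) (hg : ∀ i, PolyTime (g i)) : PolyTime fun v => f fun i => g i v :=
  comp_erasing hf.erasing hg

/-- Composing with projections works on copies of the arguments, so a program may destroy its own.
-/
theorem of_erasing {f : (Fin n → List Bool) → List Bool} (h : PolyTimeErasing f) : PolyTime f :=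
  comp_erasing h proj

end PolyTime

theorem comp_val_eq_snoc {n : ℕ} (s : Regs) : (fun i : Fin (n + 1) => s i) =
    Fin.snoc (α := fun _ => List Bool) (fun i : Fin n => s i) (s n) := by
  funext i
  refine Fin.lastCases ?_ (fun i => ?_) i <;> simp

theorem totalLength_snoc {n : ℕ} (v : Fin n → List Bool) (z : List Bool) :
    totalLength (Fin.snoc (α := fun _ => List Bool) v z) = totalLength v + z.length := by
  simp [totalLength, Fin.sum_univ_castSucc]

namespace PolyTime

variable {n m : ℕ}

/-- The loop body of a recursion: stack `n` holds the part `z` already processed, `n + 1` the value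
at `z`, `n + 2` the pending bits. The new value is computed in `n + 3` and moved to `n + 1` through
`n + 4`. -/
theorem impl_recursion_step {h : (Fin (n + 2) → List Bool) → List Bool} (hh : PolyTime h)
    (b : Bool) : ∃ P : Polynomial ℕ, Impl fun s (_ : Unit) s' t => (∀ i ≥ n + 3, s i = []) ∧
      s' = Function.update (Function.update s (n + 1) (h fun i => s i)) n (b :: s n) ∧
      t = P.eval (totalLength fun i : Fin (n + 2) => s i) +
        (3 * (s (n + 1)).length + 6 * (h fun i => s i).length + 7) := by
  obtain ⟨P, hP⟩ := hh.exists_impl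
  refine ⟨P, ((hP (n + 3) (by omega)).seq ((Impl.clear (n + 1)).seq
    ((Impl.moveRev (i := n + 3) (j := n + 4) (by omega)).seq
    ((Impl.moveRev (i := n + 4) (j := n + 1) (by omega)).seq (Impl.push n b))))).mono ?_⟩
  rintro s ⟨⟩ s' t ⟨hs, rfl, rfl⟩
  have h1 := hs (n + 3) le_rfl
  have h2 := hs (n + 4) (by omega)
  refine ⟨_, ?_, _, _, _, ⟨hs, rfl, rfl⟩, ⟨_, _, _, ⟨rfl, rfl⟩, ⟨_, _, _, ⟨rfl, rfl⟩,
    ⟨_, _, _, ⟨rfl, rfl⟩, ⟨?_, rfl⟩, rfl⟩, rfl⟩, rfl⟩, rfl⟩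
  · simp [h2]
    omega
  · funext i
    simp only [Function.update_apply]
    split_ifs <;> first | omega | simp_all

/-- Closure under bounded recursion on notation. -/
theorem recursion {g : (Fin n → List Bool) → List Bool}
    {h : Bool → (Fin (n + 2) → List Bool) → List Bool} (hg : PolyTime g)
    (hh : ∀ b, PolyTime (h b)) {f : (Fin n → List Bool) → List Bool → List Bool}
    (f_nil : ∀ v, f v [] = g v)
    (f_cons : ∀ v b z, f v (b :: z) = h b (Fin.snoc (α := fun _ => List Bool)
      (Fin.snoc (α := fun _ => List Bool) v z) (f v z)))
    (Q : Polynomial ℕ) (hQ : ∀ v z, (f v z).length ≤ Q.eval (totalLength v + z.length)) :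
    PolyTime fun w : Fin (n + 1) → List Bool => f (Fin.init w) (w (Fin.last n)) := by
  choose P hP using fun b => impl_recursion_step (hh b) b
  obtain ⟨Pg, hPg⟩ := hg.exists_impl
  -- A bound for one round: the step function gets arguments of total length at most N + Q(N);
  -- clearing the old value costs 3 per bit, moving the new one twice 6 per bit, and the loop adds 2
  -- to the constant 7.
  set B : Polynomial ℕ := (P false + P true).comp (Polynomial.X + Q) + 9 * Q + 9 with hB
  refine ⟨Pg + Polynomial.X * B + (3 * Polynomial.X + 4), ?_⟩
  -- Reversing the recursion argument onto stack `n + 2` makes the loop consume it from its last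
  -- bit, in the order in which the recursion unwinds.
  refine ((hPg (n + 1) (by omega)).seq ((Impl.moveRev (i := n) (j := n + 2) (by omega)).seq
    (Impl.forEach (n + 2) hP))).mono ?_
  -- Bits only migrate from stack `n + 2` to stack `n`, so one bound `N` serves all rounds. The a
  -- priori bound `Q` prevents the cost from compounding.
  have loop : ∀ (N : ℕ) (w : List Bool) (s : Regs) (v : Fin n → List Bool),
      v = (fun i : Fin n => s i) → (∀ i ≥ n + 3, s i = []) → s (n + 2) = w →
      s (n + 1) = f v (s n) → totalLength v + (s n).length + w.length ≤ N →
      ∃ t ≤ w.length * B.eval N + 2, ForEachRel (n + 2) (fun b s (_ : Unit) s' t =>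
        (∀ i ≥ n + 3, s i = []) ∧
        s' = Function.update (Function.update s (n + 1) (h b fun i => s i)) n (b :: s n) ∧
        t = (P b).eval (totalLength fun i : Fin (n + 2) => s i) +
          (3 * (s (n + 1)).length + 6 * (h b fun i => s i).length + 7)) s ()
        (Function.update (Function.update (Function.update s (n + 2) []) n (w.reverse ++ s n))
          (n + 1) (f v (w.reverse ++ s n))) t := by
    intro N w
    induction w with
    | nil =>
      intro s v hv hs hw hf _
      refine ⟨2, by simp, ?_⟩
      convert ForEachRel.nil hw using 1
      funext i
      simp only [Function.update_apply]
      split_ifs <;> simp_all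
    | cons b w ih =>
      intro s v hv hs hw hf hN
      simp only [List.length_cons] at hN
      set s₁ := Function.update s (n + 2) w with hs₁
      have hs₁n : s₁ n = s n := by simp [hs₁]
      have hs₁n1 : s₁ (n + 1) = f v (s n) := by simp [hs₁, hf]
      have hvec : (fun i : Fin (n + 2) => s₁ i) = Fin.snoc (α := fun _ => List Bool)
          (Fin.snoc (α := fun _ => List Bool) v (s n)) (f v (s n)) := by
        rw [comp_val_eq_snoc, comp_val_eq_snoc, hs₁n, hs₁n1]
        congr 2
        rw [hv]
        funext i
        rw [hs₁, Function.update_of_ne (by omega)]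
      have hval : (h b fun i : Fin (n + 2) => s₁ i) = f v (b :: s n) := by rw [hvec, f_cons]
      have hlen : totalLength (fun i : Fin (n + 2) => s₁ i) ≤ N + Q.eval N := by
        rw [hvec, totalLength_snoc, totalLength_snoc]
        have := (hQ v (s n)).trans (Q.eval_mono_nat (show totalLength v + (s n).length ≤ N by omega))
        simp only at this
        omega
      obtain ⟨t, ht, hr⟩ := ih
        (Function.update (Function.update s₁ (n + 1) (f v (b :: s n))) n (b :: s n)) v (by
          rw [hv]
          funext i
          rw [Function.update_of_ne (by omega), Function.update_of_ne (by omega), hs₁,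
            Function.update_of_ne (by omega)])
        (by
          intro i hi
          rw [Function.update_of_ne (by omega), Function.update_of_ne (by omega), hs₁,
            Function.update_of_ne (by omega), hs i hi])
        (by simp [hs₁]) (by simp) (by simp; omega)
      rw [← hval, ← hs₁n] at hr
      refine ⟨(P b).eval (totalLength fun i : Fin (n + 2) => s₁ i) + (3 * (s₁ (n + 1)).length +
        6 * (h b fun i => s₁ i).length + 7) + t + 2, ?_, ?_⟩
      rotate_left 1
      · convert ForEachRel.cons hw ⟨fun i hi => ?_, rfl, rfl⟩ hr using 1
        · rw [hval]
          funext i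
          simp only [Function.update_apply, hs₁]
          clear hr hvec hval hlen hs₁n hs₁n1 hs₁ s₁ ih hv hf
          split_ifs <;> first | omega | (subst_vars; simp)
        · rw [Function.update_of_ne (by omega), hs i hi]
      · rw [hval, hs₁n1]
        have h1 : (P b).eval (totalLength fun i : Fin (n + 2) => s₁ i) ≤
            (P false).eval (N + Q.eval N) + (P true).eval (N + Q.eval N) := by
          refine ((P b).eval_mono_nat hlen).trans ?_
          cases b <;> simp
        have h2 := (hQ v (s n)).trans
          (Q.eval_mono_nat (show totalLength v + (s n).length ≤ N by omega))
        have h3 := (hQ v (b :: s n)).trans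
          (Q.eval_mono_nat (show totalLength v + (b :: s n).length ≤ N by
            simp only [List.length_cons]; omega))
        have h4 : B.eval N = (P false).eval (N + Q.eval N) + (P true).eval (N + Q.eval N) +
            9 * Q.eval N + 9 := by simp [hB]
        simp only at h2 h3
        simp only [List.length_cons, add_mul, one_mul]
        omega
  rintro s ⟨⟩ s' t ⟨hs, rfl, rfl⟩
  have hn1 := hs (n + 1) (by omega)
  have hn2 := hs (n + 2) (by omega)
  set v : Fin n → List Bool := fun i => s i with hv
  have htot : totalLength (fun i : Fin (n + 1) => s i) = totalLength v + (s n).length := by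
    rw [comp_val_eq_snoc, totalLength_snoc]
  rw [htot]
  set s₁ := Function.update (Function.update (Function.update s (n + 1) (g v)) n []) (n + 2)
    (s n).reverse with hs₁
  obtain ⟨t, ht, hr⟩ := loop (totalLength v + (s n).length) (s n).reverse s₁ v (by
      funext i
      rw [hs₁, Function.update_of_ne (by omega), Function.update_of_ne (by omega),
        Function.update_of_ne (by omega)])
    (by
      intro i hi
      rw [hs₁, Function.update_of_ne (by omega), Function.update_of_ne (by omega),
        Function.update_of_ne (by omega), hs i (by omega)])
    (by simp [hs₁]) (by simp [hs₁, f_nil]) (by simp [hs₁])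
  refine ⟨_, ?_, _, _, _, ⟨fun i hi => hs i (by omega), rfl, rfl⟩, ⟨s₁, _, t, ⟨?_, rfl⟩, ?_, rfl⟩,
    rfl⟩
  · simp only [ne_eq, Nat.left_eq_add, one_ne_zero, not_false_eq_true, Function.update_of_ne,
      Polynomial.eval_add, Polynomial.eval_mul, Polynomial.eval_X, Polynomial.eval_ofNat]
    have h1 : Pg.eval (totalLength v) ≤ Pg.eval (totalLength v + (s n).length) :=
      Pg.eval_mono_nat (by omega)
    have h2 : (s n).length * B.eval (totalLength v + (s n).length) ≤
        (totalLength v + (s n).length) * B.eval (totalLength v + (s n).length) :=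
      Nat.mul_le_mul_right _ (by omega)
    simp only [List.length_reverse] at ht
    omega
  · rw [hs₁, Function.update_of_ne (by omega), Function.update_of_ne (by omega), hn2,
      List.append_nil]
  · convert hr using 1
    funext i
    have : Fin.init (fun i : Fin (n + 1) => s i) = v := by
      funext i
      simp [Fin.init, hv]
    simp only [Function.update_apply, hs₁, this]
    clear_value v
    clear hr loop htot ht hs₁ s₁ this
    split_ifs <;> first | omega | (subst_vars; simp [hn2])

end PolyTime

/-! ### Finite transducers and case distinctions -/

/-- The output of a finite transducer that reads two strings in parallel. -/
def transduce {σ : Type} (δ : σ → Option Bool → Option Bool → σ × Option Bool)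
    (fin : σ → Option Bool) (q : σ) (x y : List Bool) : List Bool :=
  if x = [] ∧ y = [] then (fin q).toList
  else (δ q x.head? y.head?).2.toList ++ transduce δ fin (δ q x.head? y.head?).1 x.tail y.tail
termination_by x.length + y.length
decreasing_by
  rename_i h
  cases x <;> cases y <;> simp_all
  omega

theorem StackProg.Impl.pushOption {β : Type} (i : ℕ) (o : Option Bool) (c : β) :
    Impl fun s b s' t => b = c ∧ s' = Function.update s i (o.toList ++ s i) ∧ t = 2 := by
  cases o with
  | none =>
    refine (Impl.pure c).mono ?_
    rintro s _ s' t ⟨rfl, rfl, rfl⟩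
    exact ⟨1, by omega, rfl, by simp, rfl⟩
  | some b =>
    refine ((Impl.push i b).seq (Impl.pure c)).mono ?_
    rintro s _ s' t ⟨rfl, rfl, rfl⟩
    exact ⟨2, le_rfl, _, 1, 1, ⟨rfl, rfl⟩, ⟨rfl, rfl, rfl⟩, rfl⟩

namespace PolyTime

variable {n : ℕ}

theorem transduce {σ : Type} [Finite σ] (δ : σ → Option Bool → Option Bool → σ × Option Bool)
    (fin : σ → Option Bool) (q : σ) :
    PolyTime fun v : Fin 2 → List Bool => transduce δ fin q (v 0) (v 1) := by
  have body : ∀ q : σ, Impl fun s (c : σ ⊕ Unit) s' t => ∃ o : Option Bool,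
      s' = Function.update (Function.update (Function.update s 0 (s 0).tail) 1 (s 1).tail) 2
        (o.toList ++ s 2) ∧ t = 4 ∧
      ((s 0 = [] ∧ s 1 = [] ∧ c = Sum.inr () ∧ o = fin q) ∨
        (¬ (s 0 = [] ∧ s 1 = []) ∧ (Sum.inl (δ q (s 0).head? (s 1).head?).1 = c ∧
          o = (δ q (s 0).head? (s 1).head?).2))) := by
    intro q
    refine ((Impl.pop 0).bind fun o₁ => (Impl.pop 1).bind fun o₂ => Impl.pushOption 2
      (if o₁ = none ∧ o₂ = none then fin q else (δ q o₁ o₂).2)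
      (if o₁ = none ∧ o₂ = none then Sum.inr () else Sum.inl (δ q o₁ o₂).1)).mono ?_
    rintro s c s' t ⟨o, rfl, rfl, h⟩
    refine ⟨4, le_rfl, _, _, 1, 3, ⟨rfl, rfl, rfl⟩, ⟨_, _, 1, 2, ⟨rfl, rfl, rfl⟩, ⟨?_, ?_, rfl⟩, rfl⟩,
      rfl⟩
    · rcases h with ⟨h1, h2, rfl, rfl⟩ | ⟨h, rfl, rfl⟩
      · simp [h1, h2]
      · rw [if_neg (by simpa using h)]
        rfl
    · rcases h with ⟨h1, h2, rfl, rfl⟩ | ⟨h, rfl, rfl⟩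
      · simp [h1, h2]
      · rw [if_neg (by simpa using h)]
        rfl
  refine of_erasing ⟨Polynomial.C 4 * Polynomial.X + 4 +
    (3 * (Polynomial.X + 1) + 2), ((Impl.iter body q).seq
      (Impl.moveRev (i := 2) (j := 0) (by omega))).mono ?_⟩
  -- A round that is not the last consumes at least one bit and emits at most one; the last may emit
  -- one more, hence `N + 1`. Output piles up in reverse on stack 2.
  have loop : ∀ (N : ℕ) (q : σ) (s : Regs), (s 0).length + (s 1).length = N →
      (_root_.transduce δ fin q (s 0) (s 1)).length ≤ N + 1 ∧
      ∃ t ≤ 4 * N + 4, IterRel (fun (q : σ) s (c : σ ⊕ Unit) s' t => ∃ o : Option Bool,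
      s' = Function.update (Function.update (Function.update s 0 (s 0).tail) 1 (s 1).tail) 2
        (o.toList ++ s 2) ∧ t = 4 ∧
      ((s 0 = [] ∧ s 1 = [] ∧ c = Sum.inr () ∧ o = fin q) ∨
        (¬ (s 0 = [] ∧ s 1 = []) ∧ (Sum.inl (δ q (s 0).head? (s 1).head?).1 = c ∧
          o = (δ q (s 0).head? (s 1).head?).2)))) q s ()
        (Function.update (Function.update (Function.update s 0 []) 1 []) 2
          ((_root_.transduce δ fin q (s 0) (s 1)).reverse ++ s 2)) t := by
    intro N
    induction N using Nat.strong_induction_on with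
    | _ N ih =>
    intro q s hN
    by_cases h : s 0 = [] ∧ s 1 = []
    · rw [_root_.transduce, if_pos h]
      refine ⟨by cases fin q <;> simp, 4, by omega, .done ⟨fin q, ?_, rfl,
        Or.inl ⟨h.1, h.2, rfl, rfl⟩⟩⟩
      simp only [h.1, h.2, List.tail_nil]
      cases fin q <;> rfl
    · have hN' : (s 0).tail.length + (s 1).tail.length + 1 ≤ N := by
        rw [← hN]
        cases h0 : s 0 <;> cases h1 : s 1 <;> simp_all
        omega
      obtain ⟨h1, t, ht, hr⟩ := ih ((s 0).tail.length + (s 1).tail.length) (by omega)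
        (δ q (s 0).head? (s 1).head?).1
        (Function.update (Function.update (Function.update s 0 (s 0).tail) 1 (s 1).tail) 2
          ((δ q (s 0).head? (s 1).head?).2.toList ++ s 2)) (by simp)
      rw [_root_.transduce, if_neg h]
      refine ⟨?_, 4 + t, by omega, .next ⟨_, rfl, rfl, Or.inr ⟨h, rfl, rfl⟩⟩ ?_⟩
      · have : (δ q (s 0).head? (s 1).head?).2.toList.length ≤ 1 := by
          cases (δ q (s 0).head? (s 1).head?).2 <;> simp
        rw [List.length_append]
        simp only [List.length_tail] at hN'
        simp at h1
        omega
      · convert hr using 1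
        funext i
        have h3 : ∀ o : Option Bool, o.toList.reverse = o.toList := by rintro (_ | _) <;> rfl
        simp only [Function.update_apply]
        split_ifs <;> simp_all
  rintro s ⟨⟩ s' t ⟨hs, rfl, rfl⟩
  obtain ⟨h1, t, ht, hr⟩ := loop _ q s rfl
  refine ⟨_, ?_, _, t, _, hr, ⟨?_, rfl⟩, rfl⟩
  · simp [totalLength, hs 2 le_rfl]
    omega
  · funext i
    simp only [Function.update_apply]
    split_ifs <;> first | omega | (simp_all; done) | exact (hs i (by omega)).symm

theorem comp₁ {op : List Bool → List Bool} (h : PolyTime fun v : Fin 1 → List Bool => op (v 0))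
    {f : (Fin n → List Bool) → List Bool} (hf : PolyTime f) : PolyTime fun v => op (f v) :=
  h.comp (g := fun _ => f) fun _ => hf

theorem comp₂ {op : List Bool → List Bool → List Bool}
    (h : PolyTime fun v : Fin 2 → List Bool => op (v 0) (v 1))
    {f g : (Fin n → List Bool) → List Bool} (hf : PolyTime f) (hg : PolyTime g) :
    PolyTime fun v => op (f v) (g v) :=
  h.comp (g := ![f, g]) fun i => by fin_cases i <;> assumption

theorem comp₃ {op : List Bool → List Bool → List Bool → List Bool}
    (h : PolyTime fun v : Fin 3 → List Bool => op (v 0) (v 1) (v 2))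
    {f g k : (Fin n → List Bool) → List Bool} (hf : PolyTime f) (hg : PolyTime g)
    (hk : PolyTime k) : PolyTime fun v => op (f v) (g v) (k v) :=
  h.comp (g := ![f, g, k]) fun i => by fin_cases i <;> assumption

theorem nil : PolyTime fun _ : Fin n → List Bool => [] := by
  refine ⟨1, (Impl.pure ()).mono ?_⟩
  rintro s ⟨⟩ s' t ⟨hs, rfl, rfl⟩
  refine ⟨1, by simp, rfl, ?_, rfl⟩
  rw [← hs n le_rfl, Function.update_eq_self]

theorem cons (b : Bool) {f : (Fin n → List Bool) → List Bool} (hf : PolyTime f) :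
    PolyTime fun v => b :: f v := by
  refine comp₁ (op := fun x => b :: x) (of_erasing ⟨1, (Impl.push 0 b).mono ?_⟩) hf
  rintro s ⟨⟩ s' t ⟨hs, rfl, rfl⟩
  refine ⟨1, by simp, ?_, rfl⟩
  funext i
  simp only [Function.update_apply]
  split_ifs with h
  · rfl
  · exact (hs i (by omega)).symm

/-- A case distinction is a recursion whose step ignores the previous value. -/
theorem ite_eq_nil {f g k : (Fin n → List Bool) → List Bool} (hf : PolyTime f) (hg : PolyTime g)
    (hk : PolyTime k) : PolyTime fun v => if f v = [] then g v else k v := by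
  have := recursion (n := 2) (proj 0) (h := fun _ v => v 1) (fun _ => proj 1)
    (f := fun v z => if z = [] then v 0 else v 1) (fun v => by simp)
    (fun v b z => by simp [Fin.snoc]) Polynomial.X (fun v z => by
      simp [totalLength]; split_ifs <;> omega)
  exact comp₃ (op := fun a b c => if c = [] then a else b) this hg hk hf

end PolyTime

/-! ### Binary arithmetic -/

/-- The number with the given binary expansion, least significant bit first. -/
def binVal : List Bool → ℕ
  | [] => 0
  | b :: l => b.toNat + 2 * binVal l

theorem binVal_bits (n : ℕ) : binVal n.bits = n := by
  induction n using Nat.binaryRec' with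
  | zero => simp [binVal]
  | bit b n h ih =>
    rw [Nat.bits_append_bit n b h, binVal, ih, Nat.bit_val]
    ring

theorem binVal_lt (l : List Bool) : binVal l < 2 ^ l.length := by
  induction l with
  | nil => simp [binVal]
  | cons b l ih =>
    rw [binVal, List.length_cons, pow_succ]
    have := b.toNat_le
    omega

/-- Binary addition with carry. -/
def binAddCarry : Bool → List Bool → List Bool → List Bool :=
  transduce (fun c o₁ o₂ =>
    (c && o₁.getD false || c && o₂.getD false || o₁.getD false && o₂.getD false,
      some (c ^^ (o₁.getD false ^^ o₂.getD false))))
    (fun c => if c then some true else none)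

/-- Binary addition. -/
def binAdd : List Bool → List Bool → List Bool := binAddCarry false

theorem binVal_tail (l : List Bool) :
    binVal l = (l.head?.getD false).toNat + 2 * binVal l.tail := by
  cases l <;> simp [binVal]

theorem binVal_binAddCarry (c : Bool) (x y : List Bool) :
    binVal (binAddCarry c x y) = c.toNat + binVal x + binVal y := by
  rw [binAddCarry]
  fun_induction transduce with
  | case1 q x y h =>
    obtain ⟨rfl, rfl⟩ := h
    cases q <;> simp [binVal]
  | case2 q x y h ih =>
    rw [binVal_tail x, binVal_tail y]
    simp only [Option.toList_some, List.singleton_append, binVal, ih]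
    cases q <;> cases x.head?.getD false <;> cases y.head?.getD false <;> simp <;> omega

theorem length_binAddCarry_le (c : Bool) (x y : List Bool) :
    (binAddCarry c x y).length ≤ max x.length y.length + 1 := by
  rw [binAddCarry]
  fun_induction transduce with
  | case1 q x y h => cases q <;> simp
  | case2 q x y h ih =>
    simp only [Option.toList_some, List.singleton_append, List.length_cons]
    cases x <;> cases y <;> simp_all

theorem binVal_binAdd (x y : List Bool) : binVal (binAdd x y) = binVal x + binVal y := by
  rw [binAdd, binVal_binAddCarry]
  simp

theorem length_binAdd_le (x y : List Bool) :
    (binAdd x y).length ≤ max x.length y.length + 1 := length_binAddCarry_le _ _ _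

/-- Comparison of binary numbers: nonempty if and only if the first is at most the second. -/
def binLE : List Bool → List Bool → List Bool :=
  transduce (fun q o₁ o₂ =>
    (if o₁.getD false = o₂.getD false then q else o₂.getD false, none))
    (fun q => if q then some true else none) true

/-- Bits arrive least significant first, so the latest disagreement decides. The induction has to
run over all verdicts `q` reached so far; the initial verdict `true` accounts for equality. -/
theorem binLE_eq_nil_iff (x y : List Bool) : binLE x y = [] ↔ binVal y < binVal x := by
  have key : ∀ q, transduce (fun q o₁ o₂ =>
      (if o₁.getD false = o₂.getD false then q else o₂.getD false, none))
      (fun q => if q then some true else none) q x y = [] ↔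
      binVal y + q.toNat ≤ binVal x := by
    intro q
    fun_induction transduce with
    | case1 q x y h =>
      obtain ⟨rfl, rfl⟩ := h
      cases q <;> simp [binVal]
    | case2 q x y h ih =>
      rw [binVal_tail x, binVal_tail y]
      simp only [Option.toList_none, List.nil_append, ih]
      cases q <;> cases x.head?.getD false <;> cases y.head?.getD false <;> simp <;> omega
  exact key true

/-- Binary multiplication. -/
def binMul : List Bool → List Bool → List Bool
  | [], _ => []
  | b :: x, y => binAdd (false :: binMul x y) (if b then y else [])

theorem binVal_binMul (x y : List Bool) : binVal (binMul x y) = binVal x * binVal y := by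
  induction x with
  | nil => simp [binMul, binVal]
  | cons b x ih =>
    rw [binMul, binVal_binAdd, binVal, binVal, ih]
    cases b <;> simp [binVal] <;> ring

/-- A round adds at most two bits, one for the shift and one for the carry. Such an a priori bound
is what bounded recursion requires. -/
theorem length_binMul_le (x y : List Bool) :
    (binMul x y).length ≤ 2 * x.length + y.length := by
  induction x with
  | nil => simp [binMul]
  | cons b x ih =>
    rw [binMul]
    refine (length_binAdd_le _ _).trans ?_
    cases b <;> simp <;> omega

/-- The binary expansion of `2 ^ n`, where `n` is the length of the argument. -/
def binTwoPow : List Bool → List Bool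
  | [] => [true]
  | _ :: x => false :: binTwoPow x

theorem binVal_binTwoPow (x : List Bool) : binVal (binTwoPow x) = 2 ^ x.length := by
  induction x with
  | nil => simp [binTwoPow, binVal]
  | cons b x ih => rw [binTwoPow, binVal, ih, List.length_cons, pow_succ]; simp; ring

namespace PolyTime

variable {n : ℕ} {f g : (Fin n → List Bool) → List Bool}

theorem binAdd (hf : PolyTime f) (hg : PolyTime g) : PolyTime fun v => binAdd (f v) (g v) :=
  comp₂ (transduce _ _ _) hf hg

theorem binLE (hf : PolyTime f) (hg : PolyTime g) : PolyTime fun v => binLE (f v) (g v) :=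
  comp₂ (transduce _ _ _) hf hg

theorem binMul (hf : PolyTime f) (hg : PolyTime g) : PolyTime fun v => binMul (f v) (g v) := by
  have := recursion (n := 1) nil
    (h := fun b v => _root_.binAdd (false :: v 2) (if b then v 0 else []))
    (fun b => binAdd (cons _ (proj 2)) (by cases b; exacts [nil, proj 0]))
    (f := fun v z => _root_.binMul z (v 0)) (fun v => by simp [_root_.binMul])
    (fun v b z => by simp [_root_.binMul, Fin.snoc]) (2 * Polynomial.X) (fun v z => by
      refine (length_binMul_le _ _).trans ?_
      simp [totalLength]
      omega)
  exact comp₂ (op := fun y x => _root_.binMul x y) this hg hf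

theorem binTwoPow (hf : PolyTime f) : PolyTime fun v => binTwoPow (f v) := by
  have := recursion (n := 0) (cons true nil) (h := fun _ v => false :: v 1)
    (fun b => cons _ (proj 1))
    (f := fun _ z => _root_.binTwoPow z) (fun v => by simp [_root_.binTwoPow])
    (fun v b z => by simp [_root_.binTwoPow, Fin.snoc]) (Polynomial.X + 1) (fun v z => by
      induction z with
      | nil => simp [_root_.binTwoPow]
      | cons b z ih => simp [_root_.binTwoPow] at ih ⊢; omega)
  exact comp₁ (op := fun x => _root_.binTwoPow x) this hf

end PolyTime

/-! ### Arithmetic decoding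

Strings are stored in reverse, their last symbol first. -/

/-- The left end of the interval of the string with reversal `z`, for the measure `μ`. -/
noncomputable def leftEnd (μ : List Bool → ℝ) : List Bool → ℝ
  | [] => 0
  | b :: z => leftEnd μ z + if b then μ (false :: z) else 0

/-- The left end of the dyadic interval of the string with reversal `p`. -/
noncomputable def dyadicLow (p : List Bool) : ℝ := binVal p / 2 ^ p.length

/-- The right end of the dyadic interval of the string with reversal `p`. -/
noncomputable def dyadicHigh (p : List Bool) : ℝ := (binVal p + 1) / 2 ^ p.length

/-- The dyadic interval of `p` lies in the interval of `z`. -/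
def Fits (μ : List Bool → ℝ) (p z : List Bool) : Prop :=
  leftEnd μ z ≤ dyadicLow p ∧ dyadicHigh p ≤ leftEnd μ z + μ z

section Decoder

variable (num den : List Bool → List Bool)

/-- The denominator of the left end of the interval of `z`. -/
def leftDen : List Bool → List Bool
  | [] => [true]
  | _ :: z => binMul (den (false :: z)) (leftDen z)

/-- The numerator of the left end of the interval of `z`. -/
def leftNum : List Bool → List Bool
  | [] => []
  | b :: z => binAdd (binMul (den (false :: z)) (leftNum z))
      (if b then binMul (num (false :: z)) (leftDen den z) else [])

/-- Does the dyadic interval of `p` start in or after the interval of `z`? -/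
def fitsLeft (p z : List Bool) : List Bool :=
  binLE (binMul (leftNum num den z) (binTwoPow p)) (binMul p (leftDen den z))

/-- Does the dyadic interval of `p` end in or before the interval of `z`? -/
def fitsRight (p z : List Bool) : List Bool :=
  binLE (binMul (binMul (binAdd p [true]) (leftDen den z)) (den z))
    (binMul (binTwoPow p)
      (binAdd (binMul (leftNum num den z) (den z)) (binMul (num z) (leftDen den z))))

/-- The next output bit, if the input `p` determines it after the output `y`. -/
def nextBit (p y : List Bool) : List Bool :=
  if fitsLeft num den p (false :: y) = [] ∨ fitsRight num den p (false :: y) = [] then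
    if fitsLeft num den p (true :: y) = [] ∨ fitsRight num den p (true :: y) = [] then []
    else [true]
  else [false]

variable {num den}

/-- The fractions are never reduced: the denominator is a product of one factor per symbol of `z`,
each of length at most `D z.length`, and multiplication adds up lengths. -/
theorem length_leftDen_le {D : ℕ → ℕ} (hD : Monotone D)
    (h : ∀ z, (den z).length ≤ D z.length) (z : List Bool) :
    (leftDen den z).length ≤ 1 + z.length * (2 * D z.length + 1) := by
  induction z with
  | nil => simp [leftDen]
  | cons b z ih =>
    rw [leftDen]
    refine (length_binMul_le _ _).trans ?_
    have h1 := h (false :: z)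
    have h2 : D z.length ≤ D (z.length + 1) := hD (Nat.le_succ _)
    have h3 : z.length * (2 * D z.length + 1) ≤ z.length * (2 * D (z.length + 1) + 1) := by gcongr
    simp only [List.length_cons] at *
    rw [add_mul]
    omega

theorem length_leftNum_le {D : ℕ → ℕ} (hD : Monotone D)
    (h : ∀ z, (den z).length ≤ D z.length) (h' : ∀ z, (num z).length ≤ D z.length)
    (z : List Bool) : (leftNum num den z).length ≤ 1 + z.length * (2 * D z.length + 1) := by
  induction z with
  | nil => simp [leftNum]
  | cons b z ih =>
    rw [leftNum]
    refine (length_binAdd_le _ _).trans ?_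
    have h1 := h (false :: z)
    have h1' := h' (false :: z)
    have h2 : D z.length ≤ D (z.length + 1) := hD (Nat.le_succ _)
    have h3 : z.length * (2 * D z.length + 1) ≤ z.length * (2 * D (z.length + 1) + 1) := by gcongr
    have h4 := length_leftDen_le hD h z
    have h5 := length_binMul_le (den (false :: z)) (leftNum num den z)
    have h6 := length_binMul_le (num (false :: z)) (leftDen den z)
    simp only [List.length_cons] at *
    rw [add_mul]
    split_ifs
    · omega
    · simp only [List.length_nil]
      omega

open PolyTime in
theorem PolyTime.leftDen (hden : PolyTime fun v : Fin 1 → List Bool => den (v 0)) :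
    PolyTime fun v : Fin 1 → List Bool => leftDen den (v 0) := by
  obtain ⟨D, hD⟩ := hden.exists_length_le
  refine recursion (n := 0) (cons true nil)
    (h := fun _ w => _root_.binMul (den (false :: w 0)) (w 1))
    (fun b => binMul (comp₁ hden (cons false (proj 0))) (proj 1))
    (f := fun _ z => _root_.leftDen den z) (fun v => by simp [_root_.leftDen])
    (fun v b z => by simp [_root_.leftDen, Fin.snoc])
    (1 + Polynomial.X * (2 * D + 1)) (fun v z => ?_)
  refine (length_leftDen_le D.eval_mono_nat (fun z => by
    simpa [totalLength] using hD ![z]) z).trans ?_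
  simp [totalLength]

open PolyTime in
theorem PolyTime.leftNum (hnum : PolyTime fun v : Fin 1 → List Bool => num (v 0))
    (hden : PolyTime fun v : Fin 1 → List Bool => den (v 0)) :
    PolyTime fun v : Fin 1 → List Bool => leftNum num den (v 0) := by
  obtain ⟨D, hD⟩ := hden.exists_length_le
  obtain ⟨N, hN⟩ := hnum.exists_length_le
  refine recursion (n := 0) nil
    (h := fun b w => _root_.binAdd (_root_.binMul (den (false :: w 0)) (w 1))
      (if b then _root_.binMul (num (false :: w 0)) (_root_.leftDen den (w 0)) else []))
    (fun b => binAdd (binMul (comp₁ hden (cons false (proj 0))) (proj 1)) ?_)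
    (f := fun _ z => _root_.leftNum num den z) (fun v => by simp [_root_.leftNum])
    (fun v b z => by simp [_root_.leftNum, Fin.snoc])
    (1 + Polynomial.X * (2 * (D + N) + 1)) (fun v z => ?_)
  · cases b
    · exact nil
    · exact binMul (comp₁ hnum (cons false (proj 0))) (comp₁ (leftDen hden) (proj 0))
  · refine (length_leftNum_le (D + N).eval_mono_nat (fun z => ?_) (fun z => ?_) z).trans ?_
    · have := hD ![z]
      simp [totalLength] at this ⊢
      omega
    · have := hN ![z]
      simp [totalLength] at this ⊢
      omega
    · simp [totalLength]

open PolyTime in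
theorem PolyTime.nextBit (hnum : PolyTime fun v : Fin 1 → List Bool => num (v 0))
    (hden : PolyTime fun v : Fin 1 → List Bool => den (v 0)) :
    PolyTime fun v : Fin 2 → List Bool => nextBit num den (v 0) (v 1) := by
  have hl : PolyTime fun v : Fin 2 → List Bool => fitsLeft num den (v 0) (v 1) :=
    binLE (binMul (comp₁ (leftNum hnum hden) (proj 1)) (binTwoPow (proj 0)))
      (binMul (proj 0) (comp₁ (leftDen hden) (proj 1)))
  have hr : PolyTime fun v : Fin 2 → List Bool => fitsRight num den (v 0) (v 1) :=
    binLE (binMul (binMul (binAdd (proj 0) (cons true nil)) (comp₁ (leftDen hden) (proj 1)))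
        (comp₁ hden (proj 1)))
      (binMul (binTwoPow (proj 0))
        (binAdd (binMul (comp₁ (leftNum hnum hden) (proj 1)) (comp₁ hden (proj 1)))
          (binMul (comp₁ hnum (proj 1)) (comp₁ (leftDen hden) (proj 1)))))
  have ite_or : ∀ {f g h k : (Fin 2 → List Bool) → List Bool}, PolyTime f → PolyTime g →
      PolyTime h → PolyTime k → PolyTime fun v => if f v = [] ∨ g v = [] then h v else k v := by
    intro f g h k hf hg hh hk
    convert ite_eq_nil hf hh (ite_eq_nil hg hh hk) using 2 with v
    by_cases h1 : f v = [] <;> by_cases h2 : g v = [] <;> simp [h1, h2]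
  exact ite_or (comp₂ hl (proj 0) (cons false (proj 1))) (comp₂ hr (proj 0) (cons false (proj 1)))
    (ite_or (comp₂ hl (proj 0) (cons true (proj 1))) (comp₂ hr (proj 0) (cons true (proj 1)))
      nil (cons true nil)) (cons false nil)

variable {μ : List Bool → ℝ}
  (hμ : ∀ z, 0 < binVal (den z) ∧ μ z = (binVal (num z) : ℝ) / binVal (den z))

include hμ

theorem binVal_leftDen_pos (z : List Bool) : 0 < binVal (leftDen den z) := by
  induction z with
  | nil => simp [leftDen, binVal]
  | cons b z ih => rw [leftDen, binVal_binMul]; exact Nat.mul_pos (hμ _).1 ih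

theorem leftEnd_eq (z : List Bool) :
    leftEnd μ z = (binVal (leftNum num den z) : ℝ) / binVal (leftDen den z) := by
  induction z with
  | nil => simp [leftEnd, leftNum, leftDen, binVal]
  | cons b z ih =>
    have h1 : (binVal (leftDen den z) : ℝ) ≠ 0 := by
      exact_mod_cast (binVal_leftDen_pos hμ z).ne'
    have h2 : (binVal (den (false :: z)) : ℝ) ≠ 0 := by exact_mod_cast (hμ _).1.ne'
    rw [leftEnd, leftNum, leftDen, binVal_binAdd, binVal_binMul, binVal_binMul, ih, (hμ _).2]
    cases b
    · simp only [Bool.false_eq_true, if_false, binVal]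
      push_cast
      field_simp
      ring
    · simp only [if_true, binVal_binMul]
      push_cast
      field_simp

/-- Both inequalities are between fractions with positive denominators; cross multiplication gives
the integer comparisons that are computed. -/
theorem fits_iff (p z : List Bool) :
    Fits μ p z ↔ ¬ (fitsLeft num den p z = [] ∨ fitsRight num den p z = []) := by
  have h1 : (0 : ℝ) < binVal (leftDen den z) := by exact_mod_cast binVal_leftDen_pos hμ z
  have h2 : (0 : ℝ) < binVal (den z) := by exact_mod_cast (hμ z).1
  have h3 : (0 : ℝ) < 2 ^ p.length := by positivity
  rw [not_or, fitsLeft, fitsRight, binLE_eq_nil_iff, binLE_eq_nil_iff, not_lt, not_lt, Fits,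
    leftEnd_eq hμ, (hμ z).2, dyadicLow, dyadicHigh, div_le_div_iff₀ h1 h3, div_add_div _ _ h1.ne' h2.ne',
    div_le_div_iff₀ h3 (mul_pos h1 h2)]
  simp only [binVal_binMul, binVal_binAdd, binVal_binTwoPow]
  refine and_congr ?_ ?_
  · rw [← Nat.cast_le (α := ℝ)]
    push_cast
    rfl
  · rw [← Nat.cast_le (α := ℝ)]
    simp only [binVal, Bool.toNat_true]
    push_cast
    rw [iff_eq_eq]
    congr 1 <;> ring

open Classical in
theorem nextBit_eq (p y : List Bool) : nextBit num den p y =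
    if Fits μ p (false :: y) then [false] else if Fits μ p (true :: y) then [true] else [] := by
  rw [nextBit]
  simp only [fits_iff hμ, ite_not]

end Decoder

/-! ### Simulation of Turing machines by stack programs -/

/-- The code of a tape symbol on a stack of bits. -/
def symCode : Option Bool → List Bool
  | none => [false]
  | some b => [true, b]

/-- The code of a list of tape symbols on a stack of bits. -/
def symsCode (l : List (Option Bool)) : List Bool := l.flatMap symCode

theorem length_symsCode_le (l : List (Option Bool)) : (symsCode l).length ≤ 2 * l.length := by
  induction l with
  | nil => simp [symsCode]
  | cons a l ih =>
    have : (symCode a).length ≤ 2 := by cases a <;> simp [symCode]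
    simp only [symsCode, List.flatMap_cons, List.length_append, List.length_cons] at *
    omega

/-- Write a symbol on a tape and move its head, where the tape is given by its parts to the left and
to the right of the head: the new scanned symbol and the new parts. -/
def tapeOp (w : Option Bool) (m : Option Turing.Dir)
    (x : List (Option Bool) × List (Option Bool)) :
    Option Bool × List (Option Bool) × List (Option Bool) :=
  match m with
  | none => (w, x)
  | some .left => (x.1.head?.join, x.1.tail, w :: x.2)
  | some .right => (x.2.head?.join, w :: x.1, x.2.tail)

theorem moveHead_write (w : Option Bool) (m : Option Turing.Dir) (h : Option Bool)
    (x : List (Option Bool) × List (Option Bool)) :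
    MonotoneTM.moveHead m (Turing.Tape.write w
      ⟨h, Turing.ListBlank.mk x.1, Turing.ListBlank.mk x.2⟩) =
    ⟨(tapeOp w m x).1, Turing.ListBlank.mk (tapeOp w m x).2.1,
      Turing.ListBlank.mk (tapeOp w m x).2.2⟩ := by
  have hh : ∀ l : List (Option Bool), (Turing.ListBlank.mk l).head = l.head?.join := by
    rintro (_ | ⟨a, l⟩) <;> rfl
  rcases m with _ | _ | _
  · rfl
  · simp [MonotoneTM.moveHead, Turing.Tape.write, Turing.Tape.move, tapeOp, hh]
  · simp [MonotoneTM.moveHead, Turing.Tape.write, Turing.Tape.move, tapeOp, hh]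

theorem length_tapeOp_le (w : Option Bool) (m : Option Turing.Dir)
    (x : List (Option Bool) × List (Option Bool)) :
    (tapeOp w m x).2.1.length ≤ x.1.length + 1 ∧ (tapeOp w m x).2.2.length ≤ x.2.length + 1 := by
  rcases m with _ | _ | _ <;> simp [tapeOp] <;> omega

namespace StackProg.Impl

/-- The first bit of a code tells whether a second one follows. An exhausted stack yields a blank,
as does the unvisited part of a tape. -/
theorem popSym (r : ℕ) : Impl fun s b s' t => ∃ l, s r = symsCode l ∧ b = l.head?.join ∧
    s' = Function.update s r (symsCode l.tail) ∧ t = 2 := by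
  have : ∀ o : Option Bool, Impl fun s b s' t => ∃ l, o.toList ++ s r = symsCode l ∧
      (o = none → s r = []) ∧ b = l.head?.join ∧
      s' = Function.update s r (symsCode l.tail) ∧ t = 1 := by
    rintro (_ | _ | _)
    · refine (Impl.pure none).mono ?_
      rintro s b s' t ⟨l, h, hs, rfl, rfl, rfl⟩
      rcases l with _ | ⟨_ | b, l⟩
      · exact ⟨1, le_rfl, rfl, by simp [symsCode, hs], rfl⟩
      · simp [symsCode, symCode, hs] at h
      · simp [symsCode, symCode, hs] at h
    · refine (Impl.pure none).mono ?_
      rintro s b s' t ⟨l, h, hs, rfl, rfl, rfl⟩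
      rcases l with _ | ⟨_ | b, l⟩
      · simp [symsCode] at h
      · simp [symsCode, symCode] at h
        exact ⟨1, le_rfl, rfl, by simp [symsCode, ← h], rfl⟩
      · simp [symsCode, symCode] at h
    · refine (Impl.pop r).mono ?_
      rintro s b s' t ⟨l, h, hs, rfl, rfl, rfl⟩
      rcases l with _ | ⟨_ | b, l⟩
      · simp [symsCode] at h
      · simp [symsCode, symCode] at h
      · simp [symsCode, symCode] at h
        exact ⟨1, le_rfl, by simp [h], by simp [symsCode, h], rfl⟩
  refine ((Impl.pop r).bind this).mono ?_
  rintro s b s' t ⟨l, h, rfl, rfl, rfl⟩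
  refine ⟨2, le_rfl, _, _, 1, 1, ⟨rfl, rfl, rfl⟩, ⟨l, ?_, ?_, rfl, by simp, rfl⟩, rfl⟩
  · rw [← h, Function.update_self]
    cases s r <;> simp
  · cases s r <;> simp

theorem pushSym (r : ℕ) (a : Option Bool) : Impl fun s (_ : Unit) s' t =>
    s' = Function.update s r (symCode a ++ s r) ∧ t = 2 := by
  cases a with
  | none =>
    refine (Impl.push r false).mono ?_
    rintro s ⟨⟩ s' t ⟨rfl, rfl⟩
    exact ⟨1, by omega, rfl, rfl⟩
  | some b =>
    refine ((Impl.push r b).seq (Impl.push r true)).mono ?_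
    rintro s ⟨⟩ s' t ⟨rfl, rfl⟩
    exact ⟨2, le_rfl, _, 1, 1, ⟨rfl, rfl⟩, ⟨by simp [symCode], rfl⟩, rfl⟩

theorem tapeOp {i j : ℕ} (hij : i ≠ j) (w : Option Bool) (m : Option Turing.Dir) :
    Impl fun s b s' t => ∃ x, s i = symsCode x.1 ∧ s j = symsCode x.2 ∧
      b = (tapeOp w m x).1 ∧ s' = Function.update (Function.update s i
        (symsCode (tapeOp w m x).2.1)) j (symsCode (tapeOp w m x).2.2) ∧ t = 4 := by
  rcases m with _ | _ | _
  · refine (Impl.pure w).mono ?_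
    rintro s b s' t ⟨x, hi, hj, rfl, rfl, rfl⟩
    refine ⟨1, by omega, rfl, ?_, rfl⟩
    simp [_root_.tapeOp, ← hi, ← hj]
  · refine ((pushSym j w).seq (popSym i)).mono ?_
    rintro s b s' t ⟨x, hi, hj, rfl, rfl, rfl⟩
    refine ⟨4, le_rfl, _, 2, 2, ⟨rfl, rfl⟩, ⟨x.1, ?_, rfl, ?_, rfl⟩, rfl⟩
    · rw [Function.update_of_ne hij, hi]
    · rw [Function.update_comm hij.symm, hj]
      rfl
  · refine ((pushSym i w).seq (popSym j)).mono ?_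
    rintro s b s' t ⟨x, hi, hj, rfl, rfl, rfl⟩
    refine ⟨4, le_rfl, _, 2, 2, ⟨rfl, rfl⟩, ⟨x.2, ?_, rfl, ?_, rfl⟩, rfl⟩
    · rw [Function.update_of_ne hij.symm, hj]
    · rw [hi]
      rfl

end StackProg.Impl

/-- The stacks that represent the unread input, the output and the tapes of a machine. -/
def simRegs {k : ℕ} (inp out : List Bool)
    (x : Fin k → List (Option Bool) × List (Option Bool)) : Regs
  | 0 => inp
  | 1 => out
  | r + 2 => if h : r / 2 < k then
      (if r % 2 = 0 then symsCode (x ⟨r / 2, h⟩).1 else symsCode (x ⟨r / 2, h⟩).2) else []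

section simRegs

variable {k : ℕ} (inp out : List Bool) (x : Fin k → List (Option Bool) × List (Option Bool))

theorem simRegs_left (i : Fin k) : simRegs inp out x (2 * i + 2) = symsCode (x i).1 := by
  simp [simRegs]

theorem simRegs_right (i : Fin k) : simRegs inp out x (2 * i + 1 + 2) = symsCode (x i).2 := by
  have h1 : (2 * (i : ℕ) + 1) / 2 = i := by omega
  have h2 : (2 * (i : ℕ) + 1) % 2 = 1 := by omega
  simp [simRegs, h1, h2]

theorem simRegs_update (i : Fin k) (y : List (Option Bool) × List (Option Bool)) :
    simRegs inp out (Function.update x i y) = Function.update (Function.update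
      (simRegs inp out x) (2 * i + 2) (symsCode y.1)) (2 * i + 1 + 2) (symsCode y.2) := by
  funext r
  rcases r with _ | _ | r
  · rw [Function.update_of_ne (by omega), Function.update_of_ne (by omega)]; rfl
  · rw [Function.update_of_ne (by omega), Function.update_of_ne (by omega)]; rfl
  · simp only [Function.update_apply]
    split_ifs with h1 h2
    · rw [h1, simRegs_right, Function.update_self]
    · rw [h2, simRegs_left, Function.update_self]
    · simp only [simRegs]
      split_ifs with h3 h4
      · rw [Function.update_of_ne]
        rintro rfl
        simp at h1 h2
        omega
      · rw [Function.update_of_ne]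
        rintro rfl
        simp at h1 h2
        omega
      · rfl

theorem update_simRegs_zero (y : List Bool) :
    Function.update (simRegs inp out x) 0 y = simRegs y out x := by
  funext r
  rcases r with _ | _ | r <;> simp [simRegs]

theorem update_simRegs_one (y : List Bool) :
    Function.update (simRegs inp out x) 1 y = simRegs inp y x := by
  funext r
  rcases r with _ | _ | r
  · rfl
  · rfl
  · rw [Function.update_of_ne (by omega)]
    rfl

theorem simRegs_of_le {r : ℕ} (h : 2 * k + 2 ≤ r) : simRegs inp out x r = [] := by
  obtain ⟨r, rfl⟩ := Nat.exists_eq_add_of_le' (show 2 ≤ r by omega)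
  simp only [simRegs]
  rw [dif_neg]
  omega

end simRegs

namespace MonotoneTM

variable {ι : Type} (T : MonotoneTM ι) (conv : Option Bool → Option ι)

/-- The effect of one round of the simulation of `T` by a stack program. -/
def SimRel (a : T.State × (Fin T.k → Option Bool)) (s : Regs)
    (c : (T.State × (Fin T.k → Option Bool)) ⊕ Unit) (s' : Regs) (t : ℕ) : Prop :=
  ∃ inp out x, s = simRegs inp out x ∧ t = 4 * T.k + 3 ∧
    match T.δ a.1 a.2 with
    | .work w m q => c = Sum.inl (q, fun i => (tapeOp (w i) (m i) (x i)).1) ∧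
        s' = simRegs inp out (fun i => (tapeOp (w i) (m i) (x i)).2)
    | .read f => c = Sum.inl (((conv inp.head?).map f).getD a.1, a.2) ∧
        s' = simRegs inp.tail out x
    | .print b q => c = Sum.inl (q, a.2) ∧ s' = simRegs inp (b :: out) x
    | .halt => c = Sum.inr () ∧ s' = s

/-- The tapes are treated one after the other, each once because `l` has no duplicates; `h` collects
the new scanned symbols in the finite control. -/
theorem impl_tapeOps {k : ℕ} (w : Fin k → Option Bool) (m : Fin k → Option Turing.Dir)
    (l : List (Fin k)) (hl : l.Nodup) (h : Fin k → Option Bool) :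
    Impl fun s b s' t => ∃ inp out x, s = simRegs inp out x ∧
      b = (fun i => if i ∈ l then (tapeOp (w i) (m i) (x i)).1 else h i) ∧
      s' = simRegs inp out (fun i => if i ∈ l then (tapeOp (w i) (m i) (x i)).2 else x i) ∧
      t = 4 * l.length + 1 := by
  induction l generalizing h with
  | nil =>
    refine (Impl.pure h).mono ?_
    rintro s b s' t ⟨inp, out, x, rfl, rfl, rfl, rfl⟩
    exact ⟨1, le_rfl, by simp, by simp, rfl⟩
  | cons j l ih =>
    obtain ⟨hj, hl⟩ := List.nodup_cons.1 hl
    refine ((Impl.tapeOp (i := 2 * j + 2) (j := 2 * j + 1 + 2) (by omega) (w j) (m j)).bind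
      fun o => ih hl (Function.update h j o)).mono ?_
    rintro s b s' t ⟨inp, out, x, rfl, rfl, rfl, rfl⟩
    refine ⟨_, ?_, _, _, 4, 4 * l.length + 1, ⟨x j, simRegs_left _ _ _ _, simRegs_right _ _ _ _,
      rfl, rfl, rfl⟩, ⟨inp, out, Function.update x j (tapeOp (w j) (m j) (x j)).2,
      (simRegs_update _ _ _ _ _).symm, ?_, ?_, rfl⟩, rfl⟩
    · simp; omega
    · funext i
      rcases eq_or_ne i j with rfl | hi
      · simp [hj]
      · simp [hi]
    · congr 1
      funext i
      rcases eq_or_ne i j with rfl | hi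
      · simp [hj]
      · simp [hi]

theorem impl_simRel (a : T.State × (Fin T.k → Option Bool)) : Impl (T.SimRel conv a) := by
  have := T.finite_state
  unfold SimRel
  rcases T.δ a.1 a.2 with ⟨w, m, q⟩ | f | ⟨b, q⟩ | _
  · refine ((impl_tapeOps w m (List.finRange T.k) (List.nodup_finRange _) a.2).bind fun h =>
      Impl.pure (Sum.inl (q, h))).mono ?_
    rintro s c s' t ⟨inp, out, x, rfl, rfl, rfl, rfl⟩
    refine ⟨_, ?_, _, _, _, 1, ⟨inp, out, x, rfl, rfl, rfl, rfl⟩, ⟨?_, ?_, rfl⟩, rfl⟩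
    · simp
    · simp
    · simp
  · refine ((Impl.pop 0).bind fun o =>
      Impl.pure (Sum.inl (((conv o).map f).getD a.1, a.2))).mono ?_
    rintro s c s' t ⟨inp, out, x, rfl, rfl, rfl, rfl⟩
    exact ⟨2, by omega, _, _, 1, 1, ⟨rfl, rfl, rfl⟩,
      ⟨rfl, (update_simRegs_zero _ _ _ _).symm, rfl⟩, rfl⟩
  · refine ((Impl.push 1 b).seq (Impl.pure (Sum.inl (q, a.2)))).mono ?_
    rintro s c s' t ⟨inp, out, x, rfl, rfl, rfl, rfl⟩
    exact ⟨2, by omega, _, 1, 1, ⟨rfl, rfl⟩,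
      ⟨rfl, (update_simRegs_one _ _ _ _).symm, rfl⟩, rfl⟩
  · refine (Impl.pure (Sum.inr ())).mono ?_
    rintro s c s' t ⟨inp, out, x, rfl, rfl, rfl, rfl⟩
    exact ⟨1, by omega, rfl, rfl, rfl⟩

variable {T conv}

/-- The stacks with parts `inp`, `out` and `x` represent the configuration `c`, where `I` relates
the unread input of the machine and the contents of the input stack. -/
structure Represents (I : List ι → List Bool → Prop) (n : ℕ) (c : T.Cfg) (h : Fin T.k → Option Bool)
    (inp out : List Bool) (x : Fin T.k → List (Option Bool) × List (Option Bool)) : Prop where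
  tapes : ∀ i, c.tapes i = ⟨h i, Turing.ListBlank.mk (x i).1, Turing.ListBlank.mk (x i).2⟩
  input : I c.input inp
  output : c.output.reverse = out
  length_output : out.length ≤ n
  length_left : ∀ i, (x i).1.length ≤ n
  length_right : ∀ i, (x i).2.length ≤ n

theorem Represents.step {I : List ι → List Bool → Prop}
    (hI : ∀ a w l, I (a :: w) l → conv l.head? = some a ∧ I w l.tail) {n : ℕ} {c : T.Cfg}
    {h : Fin T.k → Option Bool} {inp out : List Bool}
    {x : Fin T.k → List (Option Bool) × List (Option Bool)} (hc : Represents I n c h inp out x)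
    (ha : action c ≠ .halt) (hr : ∀ f, action c = .read f → c.input ≠ []) :
    ∃ h' inp' out' x', T.SimRel conv (c.state, h) (simRegs inp out x)
      (Sum.inl ((MonotoneTM.step c).state, h')) (simRegs inp' out' x') (4 * T.k + 3) ∧
      Represents I (n + 1) (MonotoneTM.step c) h' inp' out' x' ∧ inp'.length ≤ inp.length := by
  have hhead : (fun i => (c.tapes i).head) = h := by
    funext i
    rw [hc.tapes]
  have hact : action c = T.δ c.state h := by rw [action, hhead]
  have h1 := hc.length_output
  have h2 := hc.length_left
  have h3 := hc.length_right
  rcases hδ : T.δ c.state h with ⟨w, m, q⟩ | f | ⟨b, q⟩ | _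
  · refine ⟨fun i => (tapeOp (w i) (m i) (x i)).1, inp, out,
      fun i => (tapeOp (w i) (m i) (x i)).2, ⟨inp, out, x, rfl, rfl, ?_⟩, ?_, le_rfl⟩
    · simp only [hδ, MonotoneTM.step, hact, and_self]
    · simp only [MonotoneTM.step, hact, hδ]
      refine ⟨fun i => ?_, hc.input, hc.output, by omega, fun i => ?_, fun i => ?_⟩
      · simp only [hc.tapes]
        exact moveHead_write _ _ _ _
      · exact (length_tapeOp_le _ _ _).1.trans (by have := h2 i; omega)
      · exact (length_tapeOp_le _ _ _).2.trans (by have := h3 i; omega)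
  · rcases hin : c.input with _ | ⟨a, w⟩
    · exact absurd hin (hr f (hact.trans hδ))
    · obtain ⟨hconv, hI'⟩ := hI a w inp (hin ▸ hc.input)
      refine ⟨h, inp.tail, out, x, ⟨inp, out, x, rfl, rfl, ?_⟩, ?_, by simp⟩
      · simp only [hδ, MonotoneTM.step, hact, hin, hconv, and_true]
        rfl
      · simp only [MonotoneTM.step, hact, hδ, hin]
        exact ⟨hc.tapes, hI', hc.output, by omega, fun i => (h2 i).trans (by omega),
          fun i => (h3 i).trans (by omega)⟩
  · refine ⟨h, inp, b :: out, x, ⟨inp, out, x, rfl, rfl, ?_⟩, ?_, le_rfl⟩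
    · simp only [hδ, MonotoneTM.step, hact, and_self]
    · simp only [MonotoneTM.step, hact, hδ]
      exact ⟨hc.tapes, hc.input, by simp [hc.output], by simpa using h1,
        fun i => (h2 i).trans (by omega), fun i => (h3 i).trans (by omega)⟩
  · exact absurd (hact.trans hδ) ha

theorem step_eq_self_of_halt {c : T.Cfg} (h : action c = .halt) : step c = c := by
  simp only [step, h]

theorem step_eq_self_of_read {c : T.Cfg} {f} (h : action c = .read f) (h' : c.input = []) :
    step c = c := by
  simp only [step, h, h']

theorem Represents.iterRel {I : List ι → List Bool → Prop}
    (hI : ∀ a w l, I (a :: w) l → conv l.head? = some a ∧ I w l.tail) (t : ℕ) {n : ℕ} {c : T.Cfg}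
    {h : Fin T.k → Option Bool} {inp out : List Bool}
    {x : Fin T.k → List (Option Bool) × List (Option Bool)} (hc : Represents I n c h inp out x)
    (ht : action (MonotoneTM.step^[t] c) = .halt) : ∃ h' inp' out' x', ∃ t' ≤ (4 * T.k + 3) * (t + 1),
      IterRel (T.SimRel conv) (c.state, h) (simRegs inp out x) () (simRegs inp' out' x') t' ∧
      Represents I (n + t) (MonotoneTM.step^[t] c) h' inp' out' x' ∧ inp'.length ≤ inp.length := by
  induction t generalizing n c h inp out x with
  | zero =>
    refine ⟨h, inp, out, x, _, le_rfl, ?_, hc, le_rfl⟩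
    refine .done ⟨inp, out, x, rfl, by ring, ?_⟩
    have hhead : (fun i => (c.tapes i).head) = h := by
      funext i
      rw [hc.tapes]
    have : T.δ c.state h = .halt := by rw [← hhead]; exact ht
    simp [this]
  | succ t ih =>
    -- A step without effect, such as waiting at the end of the input, is skipped instead of
    -- simulated; this only shortens the run.
    by_cases ha : MonotoneTM.step c = c
    · rw [Function.iterate_succ_apply, ha] at ht ⊢
      obtain ⟨h', inp', out', x', t', ht', hr, hc', hl⟩ := ih hc ht
      exact ⟨h', inp', out', x', t', ht'.trans (by gcongr; omega), hr,
        ⟨hc'.tapes, hc'.input, hc'.output, hc'.length_output.trans (by omega),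
          fun i => (hc'.length_left i).trans (by omega),
          fun i => (hc'.length_right i).trans (by omega)⟩, hl⟩
    · obtain ⟨h', inp', out', x', hs, hc', hl⟩ := hc.step hI
        (fun h => ha (step_eq_self_of_halt h)) (fun f h h' => ha (step_eq_self_of_read h h'))
      rw [Function.iterate_succ_apply] at ht ⊢
      obtain ⟨h'', inp'', out'', x'', t', ht', hr, hc'', hl'⟩ := ih hc' ht
      refine ⟨h'', inp'', out'', x'', _, ?_, .next hs hr, ?_, hl'.trans hl⟩
      · linarith
      · rwa [add_assoc, add_comm 1] at hc''

variable (T) in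
theorem exists_iterRel {I : List ι → List Bool → Prop}
    (hI : ∀ a w l, I (a :: w) l → conv l.head? = some a ∧ I w l.tail) {w : List ι}
    {inp y : List Bool} (hw : I w inp) {t : ℕ} (ht : T.HaltsAt w y t) : ∃ inp',
      ∃ x : Fin T.k → List (Option Bool) × List (Option Bool),
      ∃ t' ≤ (4 * T.k + 3) * (t + 1),
      IterRel (T.SimRel conv) (T.start, fun _ => none) (Function.update (fun _ => []) 0 inp) ()
        (simRegs inp' y.reverse x) t' ∧ I (T.run w t).input inp' ∧ inp'.length ≤ inp.length ∧
      ∀ r, (simRegs inp' y.reverse x r).length ≤ inp.length + 2 * t := by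
  have h0 : Represents I 0 (T.init w) (fun _ => none) inp [] (fun _ => ([], [])) :=
    ⟨fun i => rfl, hw, rfl, le_rfl, fun _ => le_rfl, fun _ => le_rfl⟩
  obtain ⟨h', inp', out', x', t', ht', hr, hc, hl⟩ := h0.iterRel hI t ht.1
  obtain rfl : y.reverse = out' := by rw [← ht.2]; exact hc.output
  refine ⟨inp', x', t', ht', ?_, hc.input, hl, ?_⟩
  · have : Function.update (fun _ => []) 0 inp =
        simRegs inp [] fun _ : Fin T.k => (([], []) : List (Option Bool) × List (Option Bool)) := by
      funext r
      rcases r with _ | _ | r <;> simp [simRegs, symsCode]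
    rw [this]
    exact hr
  · have h1 := hc.length_output
    intro r
    rcases r with _ | _ | r
    · simp only [simRegs]; omega
    · simp only [simRegs]; omega
    · simp only [simRegs]
      split_ifs with h
      · have h2 := length_symsCode_le (x' ⟨r / 2, h⟩).1
        have h3 := hc.length_left ⟨r / 2, h⟩
        omega
      · have h2 := length_symsCode_le (x' ⟨r / 2, h⟩).2
        have h3 := hc.length_right ⟨r / 2, h⟩
        omega
      · simp

end MonotoneTM

namespace PolyTime

variable {n : ℕ} {ι : Type} (T : MonotoneTM ι)

theorem impl_simulation (conv : Option Bool → Option ι) :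
    Impl (StackProg.IterRel (T.SimRel conv) (T.start, fun _ => none)) :=
  have := T.finite_state
  Impl.iter (T.impl_simRel conv) _

theorem sum_simRegs_le {k M : ℕ} {inp out : List Bool}
    {x : Fin k → List (Option Bool) × List (Option Bool)}
    (h : ∀ r, (simRegs inp out x r).length ≤ M) (i : ℕ) (j : ℕ) (y : List Bool) (hj : 2 * k + 2 ≤ j) :
    ∑ r ∈ Finset.range (2 * k + 2),
      (Function.update (Function.update (simRegs inp out x) i []) j y r).length ≤
      (2 * k + 2) * M := by
  refine (Finset.sum_le_card_nsmul _ _ M fun r hr => ?_).trans (by simp)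
  rw [Function.update_of_ne (by have := Finset.mem_range.1 hr; omega), Function.update_apply]
  split_ifs
  · simp
  · exact h r

/-- Imports a given Turing machine into the class. The relation `I` between machine input and stack
contents leaves room for an end marker and for trailing bits that the machine does not reach. -/
theorem of_haltsAt {g h : (Fin n → List Bool) → List Bool} (hg : PolyTime g)
    {conv : Option Bool → Option ι} {I : List ι → List Bool → Prop}
    (hI : ∀ a w l, I (a :: w) l → conv l.head? = some a ∧ I w l.tail)
    {w : (Fin n → List Bool) → List ι} (hw : ∀ v, I (w v) (g v)) (P : Polynomial ℕ)
    (hT : ∀ v, ∃ t ≤ P.eval (totalLength v), T.HaltsAt (w v) (h v) t) : PolyTime h := by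
  obtain ⟨Q, hQ⟩ := hg.exists_length_le
  obtain ⟨Pg, hg⟩ := hg.erasing
  set N := 2 * T.k + 2 with hN
  refine of_erasing ⟨Pg + (Polynomial.C (4 * T.k + 3) * (P + 1) +
    (9 * (Q + 2 * P) + 6 + (3 * Polynomial.C N * (Q + 2 * P) + Polynomial.C (2 * N + 1)))),
    -- The simulated output has its last bit on top; the three moves to `N`, `N + 1` and 0 put it in
    -- order.
    (hg.seq ((impl_simulation T conv).seq ((Impl.moveRev (i := 1) (j := N) (by omega)).seq
      ((Impl.clearAll N).seq ((Impl.moveRev (i := N) (j := N + 1) (by omega)).seq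
        (Impl.moveRev (i := N + 1) (j := 0) (by omega))))))).mono ?_⟩
  rintro s ⟨⟩ s' t ⟨hs, rfl, rfl⟩
  set v : Fin n → List Bool := fun i => s i
  obtain ⟨t₀, ht₀, hh⟩ := hT v
  obtain ⟨inp', x, t', ht', hr, -, -, hlen⟩ := T.exists_iterRel hI (hw v) hh
  refine ⟨_, ?_, _, _, _, ⟨hs, rfl, rfl⟩, ⟨_, _, _, hr, ⟨_, _, _, ⟨rfl, rfl⟩, ⟨_, _, _, ⟨rfl, rfl⟩,
    ⟨_, _, _, ⟨rfl, rfl⟩, ⟨?_, rfl⟩, rfl⟩, rfl⟩, rfl⟩, rfl⟩, rfl⟩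
  · have h1 := sum_simRegs_le hlen 1 N ((simRegs inp' (h v).reverse x 1).reverse ++
      simRegs inp' (h v).reverse x N) le_rfl
    have h2 := hlen 1
    have h3 := hQ v
    have h4 : (4 * T.k + 3) * (t₀ + 1) ≤ (4 * T.k + 3) * (P.eval (totalLength v) + 1) := by gcongr
    have h5 : N * ((g v).length + 2 * t₀) ≤
        N * (Q.eval (totalLength v) + 2 * P.eval (totalLength v)) := by gcongr
    have h6 : 3 * N * (Q.eval (totalLength v) + 2 * P.eval (totalLength v)) =
        3 * (N * (Q.eval (totalLength v) + 2 * P.eval (totalLength v))) := by ring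
    have h7 : simRegs inp' (h v).reverse x N = [] := simRegs_of_le _ _ _ le_rfl
    have h8 : simRegs inp' (h v).reverse x (N + 1) = [] := simRegs_of_le _ _ _ (by omega)
    have h9 : simRegs inp' (h v).reverse x 1 = (h v).reverse := rfl
    rw [← hN] at h1
    simp only [h7, h9, List.reverse_reverse, List.append_nil, List.length_reverse] at h1 h2
    simp [h7, h8, h9, h6]
    omega
  · funext r
    have h7 : simRegs inp' (h v).reverse x N = [] := simRegs_of_le _ _ _ le_rfl
    have h8 : simRegs inp' (h v).reverse x (N + 1) = [] := simRegs_of_le _ _ _ (by omega)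
    have h9 : simRegs inp' (h v).reverse x 1 = (h v).reverse := rfl
    by_cases hr0 : r = 0
    · subst hr0
      simp [h7, h8, h9, show 0 < N by omega]
    · by_cases hrN : r < N
      · simp [hr0, hrN, hrN.ne, show r ≠ N + 1 by omega]
      · by_cases hrN' : r = N
        · simp [hrN', show N ≠ 0 by omega]
        · by_cases hrN1 : r = N + 1
          · simp [hrN1]
          · simp [hr0, hrN, hrN', hrN1, show r ≠ 1 by omega,
              simRegs_of_le inp' (h v).reverse x (show 2 * T.k + 2 ≤ r by omega)]

/-- A decoder that has consumed exactly its code word leaves the remaining bits on the input stack.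
This splits a concatenation of two code words. -/
theorem of_haltsAt_rest {g r : (Fin n → List Bool) → List Bool} (T : MonotoneTM Bool)
    (hg : PolyTime g) {w y : (Fin n → List Bool) → List Bool} (hw : ∀ v, g v = w v ++ r v)
    (P : Polynomial ℕ) (hT : ∀ v, ∃ t ≤ P.eval (totalLength v), T.HaltsAt (w v) (y v) t ∧
      (T.run (w v) t).input = []) : PolyTime r := by
  obtain ⟨Q, hQ⟩ := hg.exists_length_le
  obtain ⟨Pg, hg⟩ := hg.erasing
  set N := 2 * T.k + 2 with hN
  refine of_erasing ⟨Pg + (Polynomial.C (4 * T.k + 3) * (P + 1) +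
    (6 * (Q + 2 * P) + 4 + (3 * Polynomial.C N * (Q + 2 * P) + Polynomial.C (2 * N + 1)))),
    (hg.seq ((impl_simulation T id).seq ((Impl.moveRev (i := 0) (j := N) (by omega)).seq
      ((Impl.clearAll N).seq (Impl.moveRev (i := N) (j := 0) (by omega)))))).mono ?_⟩
  rintro s ⟨⟩ s' t ⟨hs, rfl, rfl⟩
  set v : Fin n → List Bool := fun i => s i
  obtain ⟨t₀, ht₀, hh, hin⟩ := hT v
  obtain ⟨inp', x, t', ht', hr, hinp, -, hlen⟩ := T.exists_iterRel (conv := id)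
    (I := fun w l => l = w ++ r v) (fun a w l hl => by subst hl; simp) (hw v) hh
  rw [hin, List.nil_append] at hinp
  subst hinp
  have h7 : simRegs (r v) (y v).reverse x N = [] := simRegs_of_le _ _ _ le_rfl
  have h9 : simRegs (r v) (y v).reverse x 0 = r v := rfl
  refine ⟨_, ?_, _, _, _, ⟨hs, rfl, rfl⟩, ⟨_, _, _, hr, ⟨_, _, _, ⟨rfl, rfl⟩, ⟨_, _, _, ⟨rfl, rfl⟩,
    ⟨?_, rfl⟩, rfl⟩, rfl⟩, rfl⟩, rfl⟩
  · have h1 := sum_simRegs_le hlen 0 N ((simRegs (r v) (y v).reverse x 0).reverse ++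
      simRegs (r v) (y v).reverse x N) le_rfl
    have h2 := hlen 0
    have h3 := hQ v
    have h4 : (4 * T.k + 3) * (t₀ + 1) ≤ (4 * T.k + 3) * (P.eval (totalLength v) + 1) := by gcongr
    have h5 : N * ((g v).length + 2 * t₀) ≤
        N * (Q.eval (totalLength v) + 2 * P.eval (totalLength v)) := by gcongr
    have h6 : 3 * N * (Q.eval (totalLength v) + 2 * P.eval (totalLength v)) =
        3 * (N * (Q.eval (totalLength v) + 2 * P.eval (totalLength v))) := by ring
    rw [← hN] at h1
    simp only [h7, h9, List.append_nil] at h1 h2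
    simp [h7, h9, h6]
    omega
  · funext r'
    by_cases hr0 : r' = 0
    · subst hr0
      simp [h7, h9, show 0 < N by omega]
    · by_cases hrN : r' < N
      · simp [hr0, hrN, hrN.ne]
      · by_cases hrN' : r' = N
        · simp [hrN', show N ≠ 0 by omega]
        · simp [hr0, hrN, hrN', simRegs_of_le (r v) (y v).reverse x
            (show 2 * T.k + 2 ≤ r' by omega)]

end PolyTime

/-! ### Dyadic intervals -/

theorem binVal_injective_of_length {p q : List Bool} (hl : p.length = q.length)
    (h : binVal p = binVal q) : p = q := by
  induction p generalizing q with
  | nil => exact (List.length_eq_zero_iff.1 hl.symm).symm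
  | cons b p ih =>
    rcases q with _ | ⟨c, q⟩
    · simp at hl
    · simp only [binVal] at h
      have hb : b = c := by cases b <;> cases c <;> simp at h ⊢ <;> omega
      subst hb
      rw [ih (by simpa using hl) (by omega)]

theorem dyadicHigh_eq (p : List Bool) : dyadicHigh p = dyadicLow p + (2 ^ p.length)⁻¹ := by
  rw [dyadicHigh, dyadicLow, add_div, one_div]

theorem dyadicLow_lt_dyadicHigh (p : List Bool) : dyadicLow p < dyadicHigh p := by
  rw [dyadicHigh_eq]
  exact lt_add_of_pos_right _ (by positivity)

theorem dyadicLow_le_cons (b : Bool) (p : List Bool) : dyadicLow p ≤ dyadicLow (b :: p) := by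
  rw [dyadicLow, dyadicLow, List.length_cons, pow_succ,
    div_le_div_iff₀ (by positivity) (by positivity), binVal]
  push_cast
  have : (0 : ℝ) ≤ (b.toNat : ℝ) * 2 ^ p.length := by positivity
  nlinarith

theorem dyadicHigh_cons_le (b : Bool) (p : List Bool) : dyadicHigh (b :: p) ≤ dyadicHigh p := by
  rw [dyadicHigh, dyadicHigh, List.length_cons, pow_succ,
    div_le_div_iff₀ (by positivity) (by positivity), binVal]
  push_cast
  have h1 : (b.toNat : ℝ) ≤ 1 := by exact_mod_cast b.toNat_le
  have h2 : (b.toNat : ℝ) * 2 ^ p.length ≤ 1 * 2 ^ p.length := by gcongr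
  nlinarith

theorem dyadic_mono {p q : List Bool} (h : p <:+ q) :
    dyadicLow p ≤ dyadicLow q ∧ dyadicHigh q ≤ dyadicHigh p := by
  obtain ⟨r, rfl⟩ := h
  induction r with
  | nil => exact ⟨le_rfl, le_rfl⟩
  | cons b r ih =>
    exact ⟨ih.1.trans (dyadicLow_le_cons _ _), (dyadicHigh_cons_le _ _).trans ih.2⟩

theorem exists_mem_dyadic {u : ℝ} (h0 : 0 ≤ u) (h1 : u < 1) (n : ℕ) :
    ∃ p : List Bool, p.length = n ∧ u ∈ Set.Ico (dyadicLow p) (dyadicHigh p) := by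
  induction n with
  | zero => exact ⟨[], rfl, by simpa [dyadicLow, dyadicHigh, binVal] using ⟨h0, h1⟩⟩
  | succ n ih =>
    obtain ⟨p, rfl, hl, hr⟩ := ih
    have h2 : dyadicLow (false :: p) = dyadicLow p := by
      rw [dyadicLow, dyadicLow, List.length_cons, pow_succ, binVal]
      field_simp
      push_cast
      simp
    have h3 : dyadicHigh (true :: p) = dyadicHigh p := by
      rw [dyadicHigh, dyadicHigh, List.length_cons, pow_succ, binVal]
      field_simp
      push_cast
      simp
      ring
    have h4 : dyadicHigh (false :: p) = dyadicLow (true :: p) := by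
      simp [dyadicHigh, dyadicLow, binVal, add_comm]
    rcases lt_or_ge u (dyadicHigh (false :: p)) with h | h
    · exact ⟨false :: p, rfl, h2 ▸ hl, h⟩
    · exact ⟨true :: p, rfl, h4 ▸ h, h3 ▸ hr⟩

/-- Dyadic intervals are nested or disjoint: cut `q` down to the length of `p`; the two numerators
then differ by less than one and so agree. -/
theorem suffix_of_mem_dyadic {u : ℝ} {p q : List Bool}
    (hp : u ∈ Set.Ico (dyadicLow p) (dyadicHigh p)) (hq : u ∈ Set.Ico (dyadicLow q) (dyadicHigh q))
    (h : p.length ≤ q.length) : p <:+ q := by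
  have hs : q.drop (q.length - p.length) <:+ q := List.drop_suffix _ _
  have hl : (q.drop (q.length - p.length)).length = p.length := by
    rw [List.length_drop]
    omega
  have hq' : u ∈ Set.Ico (dyadicLow (q.drop (q.length - p.length)))
      (dyadicHigh (q.drop (q.length - p.length))) :=
    ⟨(dyadic_mono hs).1.trans hq.1, hq.2.trans_le (dyadic_mono hs).2⟩
  generalize q.drop (q.length - p.length) = r at *
  obtain rfl : r = p := by
    refine binVal_injective_of_length hl ?_
    rw [Set.mem_Ico, dyadicLow, dyadicHigh, div_le_iff₀ (by positivity),
      lt_div_iff₀ (by positivity)] at hp hq'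
    rw [hl] at hq'
    have h1 : (binVal r : ℝ) < binVal p + 1 := hq'.1.trans_lt hp.2
    have h2 : (binVal p : ℝ) < binVal r + 1 := hp.1.trans_lt hq'.2
    norm_cast at h1 h2
    omega
  exact hs

/-! ### Dyadic intervals inside the intervals of a semimeasure -/

section Semimeasure

variable {μ : List Bool → ℝ}

theorem Fits.of_suffix_left {p q z : List Bool} (h : Fits μ p z) (hpq : p <:+ q) : Fits μ q z :=
  ⟨h.1.trans (dyadic_mono hpq).1, (dyadic_mono hpq).2.trans h.2⟩

theorem Fits.pos {p z : List Bool} (h : Fits μ p z) : 0 < μ z := by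
  have := dyadicLow_lt_dyadicHigh p
  linarith [h.1, h.2]

theorem Fits.false_of_cons {p z : List Bool} (h : Fits μ p (false :: z))
    (h' : Fits μ p (true :: z)) : False := by
  have h1 := h.2
  have h2 := h'.1
  have := dyadicLow_lt_dyadicHigh p
  simp only [leftEnd, Bool.false_eq_true, if_false, if_true, add_zero] at h1 h2
  linarith

variable (nonneg : ∀ z, 0 ≤ μ z) (add_le : ∀ z, μ (false :: z) + μ (true :: z) ≤ μ z)

include nonneg add_le

theorem Fits.tail {p : List Bool} {b : Bool} {z : List Bool} (h : Fits μ p (b :: z)) :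
    Fits μ p z := by
  obtain ⟨h1, h2⟩ := h
  have h3 := add_le z
  have h4 := nonneg (true :: z)
  have h5 := nonneg (false :: z)
  rw [leftEnd] at h1 h2
  cases b
  · simp only [Bool.false_eq_true, if_false] at h1 h2
    exact ⟨by linarith, by linarith⟩
  · simp only [if_true] at h1 h2
    exact ⟨by linarith, by linarith⟩

theorem Fits.of_suffix_right {p z z' : List Bool} (h : Fits μ p z) (hz : z' <:+ z) :
    Fits μ p z' := by
  obtain ⟨r, rfl⟩ := hz
  induction r with
  | nil => exact h
  | cons b r ih => exact ih (h.tail nonneg add_le)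

/-- Sibling intervals are disjoint and children lie in their parent, so the strings whose interval
contains that of `p` form a chain. -/
theorem Fits.suffix_or_suffix {p z z' : List Bool} (h : Fits μ p z) (h' : Fits μ p z')
    (hl : z.length ≤ z'.length) : z <:+ z' := by
  induction z' generalizing z with
  | nil => rw [List.length_eq_zero_iff.1 (Nat.le_zero.1 hl)]
  | cons b z' ih =>
    rcases hl.lt_or_eq with hl | hl
    · exact (ih h (h'.tail nonneg add_le) (Nat.lt_succ_iff.1 hl)).trans (List.suffix_cons _ _)
    · rcases z with _ | ⟨c, z⟩
      · exact List.nil_suffix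
      · have hs := ih (h.tail nonneg add_le) (h'.tail nonneg add_le) (by simp at hl; omega)
        obtain rfl : z = z' := hs.eq_of_length (by simpa using hl)
        cases b <;> cases c
        · exact List.suffix_rfl
        · exact (h'.false_of_cons h).elim
        · exact (h.false_of_cons h').elim
        · exact List.suffix_rfl

/-- The interval of `p` lies in the interval of `z`, and `p` is minimal with this property. -/
def MinFits (μ : List Bool → ℝ) (p z : List Bool) : Prop :=
  Fits μ p z ∧ ∀ q, q <:+ p → Fits μ q z → q = p

omit nonneg add_le in
theorem Fits.exists_minFits {p z : List Bool} (h : Fits μ p z) : ∃ q, q <:+ p ∧ MinFits μ q z := by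
  induction p with
  | nil => exact ⟨[], List.suffix_rfl, h, fun q hq _ => List.suffix_nil.1 hq⟩
  | cons b p ih =>
    by_cases hp : Fits μ p z
    · obtain ⟨q, hq, hm⟩ := ih hp
      exact ⟨q, hq.trans (List.suffix_cons _ _), hm⟩
    · refine ⟨b :: p, List.suffix_rfl, h, fun q hq hf => ?_⟩
      rcases List.suffix_cons_iff.1 hq with rfl | hq
      · rfl
      · exact absurd (hf.of_suffix_left hq) hp

omit add_le in
theorem leftEnd_nonneg (z : List Bool) : 0 ≤ leftEnd μ z := by
  induction z with
  | nil => exact le_rfl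
  | cons b z ih =>
    rw [leftEnd]
    split_ifs
    · linarith [nonneg (false :: z)]
    · linarith

theorem leftEnd_add_le (nil_le : μ [] ≤ 1) (z : List Bool) : leftEnd μ z + μ z ≤ 1 := by
  induction z with
  | nil => simpa [leftEnd] using nil_le
  | cons b z ih =>
    have h3 := add_le z
    have h4 := nonneg (true :: z)
    have h5 := nonneg (false :: z)
    rw [leftEnd]
    cases b
    · simp only [Bool.false_eq_true, if_false]
      linarith
    · simp only [if_true]
      linarith

/-- A dyadic interval of length at most ε around a point that is ε away from both ends cannot leave
the interval. -/
theorem fits_of_mem (nil_le : μ [] ≤ 1) {z : List Bool} {u ε : ℝ} (h1 : leftEnd μ z + ε ≤ u)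
    (h2 : u + ε ≤ leftEnd μ z + μ z) (hε : 0 < ε) {n : ℕ} (hn : ((2 : ℝ) ^ n)⁻¹ ≤ ε) :
    ∃ p : List Bool, p.length = n ∧ u ∈ Set.Ico (dyadicLow p) (dyadicHigh p) ∧ Fits μ p z := by
  have h3 := leftEnd_nonneg nonneg z
  have h4 := leftEnd_add_le nonneg add_le nil_le z
  obtain ⟨p, rfl, hp⟩ := exists_mem_dyadic (by linarith : 0 ≤ u) (by linarith) n
  have h5 := dyadicHigh_eq p
  have h6 := hp.1
  have h7 := hp.2
  exact ⟨p, rfl, hp, by linarith, by linarith⟩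

theorem exists_minFits_le (nil_le : μ [] ≤ 1) {z : List Bool} (hz : 0 < μ z) :
    ∃ p, MinFits μ p z ∧ μ z / 4 ≤ (2 ^ p.length)⁻¹ := by
  have h1 := leftEnd_add_le nonneg add_le nil_le z
  have h2 := leftEnd_nonneg nonneg z
  -- Here 2^n ≤ 2/μ(z) < 2^(n+1). With n + 1 bits the dyadic interval of the midpoint is shorter
  -- than μ(z)/2, hence fits, and still has length at least μ(z)/4.
  obtain ⟨n, hn, hn'⟩ := exists_nat_pow_near (x := 2 / μ z) (y := 2)
    (by rw [le_div_iff₀ hz]; linarith) (by norm_num)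
  rw [le_div_iff₀ hz] at hn
  rw [div_lt_iff₀ hz] at hn'
  obtain ⟨p, hp, -, hf⟩ := fits_of_mem nonneg add_le nil_le (z := z) (u := leftEnd μ z + μ z / 2)
    (ε := μ z / 2) (by linarith) (by linarith) (by linarith) (n := n + 1) (by
      rw [inv_le_comm₀ (by positivity) (by positivity), inv_div, div_le_iff₀ hz]
      exact hn'.le)
  obtain ⟨q, hq, hm⟩ := hf.exists_minFits
  refine ⟨q, hm, ?_⟩
  have h3 : (2 : ℝ) ^ q.length ≤ 2 ^ (n + 1) := by
    gcongr
    · norm_num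
    · exact hp ▸ hq.length_le
  refine le_trans ?_ (inv_anti₀ (by positivity) h3)
  rw [le_inv_comm₀ (by positivity) (by positivity), inv_div, le_div_iff₀ hz, pow_succ]
  linarith

open MeasureTheory in
-- By minimality the dyadic intervals are disjoint. Their union lies between the open and the
-- half-open interval of `z`, so its Lebesgue measure is μ(z).
theorem hasSum_minFits (nil_le : μ [] ≤ 1) (z : List Bool) :
    HasSum (fun p : {p // MinFits μ p z} => ((2 : ℝ) ^ p.1.length)⁻¹) (μ z) := by
  set I : {p // MinFits μ p z} → Set ℝ := fun p => Set.Ico (dyadicLow p.1) (dyadicHigh p.1) with hI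
  have hd : Pairwise (Function.onFun Disjoint I) := by
    rintro ⟨p, hp⟩ ⟨q, hq⟩ hpq
    refine Set.disjoint_left.2 fun u hu hu' => hpq (Subtype.ext ?_)
    rcases le_total p.length q.length with h | h
    · exact hq.2 _ (suffix_of_mem_dyadic hu hu' h) hp.1
    · exact (hp.2 _ (suffix_of_mem_dyadic hu' hu h) hq.1).symm
  have hvol : ∀ p, volume (I p) = ENNReal.ofReal ((2 : ℝ) ^ p.1.length)⁻¹ := by
    intro p
    rw [hI, Real.volume_Ico, dyadicHigh_eq, add_sub_cancel_left]
  have hU : volume (⋃ p, I p) = ENNReal.ofReal (μ z) := by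
    apply le_antisymm
    · calc volume (⋃ p, I p) ≤ volume (Set.Ico (leftEnd μ z) (leftEnd μ z + μ z)) :=
            measure_mono (Set.iUnion_subset fun p => Set.Ico_subset_Ico p.2.1.1 p.2.1.2)
        _ = _ := by rw [Real.volume_Ico, add_sub_cancel_left]
    · calc ENNReal.ofReal (μ z) = volume (Set.Ioo (leftEnd μ z) (leftEnd μ z + μ z)) := by
            rw [Real.volume_Ioo, add_sub_cancel_left]
        _ ≤ _ := by
            refine measure_mono fun u hu => ?_
            have hε : 0 < min (u - leftEnd μ z) (leftEnd μ z + μ z - u) :=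
              lt_min (by linarith [hu.1]) (by linarith [hu.2])
            obtain ⟨n, hn⟩ := exists_pow_lt_of_lt_one hε (by norm_num : (2 : ℝ)⁻¹ < 1)
            rw [inv_pow] at hn
            obtain ⟨p, -, hup, hf⟩ := fits_of_mem nonneg add_le nil_le
              (u := u) (by linarith [min_le_left (u - leftEnd μ z) (leftEnd μ z + μ z - u)])
              (by linarith [min_le_right (u - leftEnd μ z) (leftEnd μ z + μ z - u)]) hε hn.le
            obtain ⟨q, hq, hm⟩ := hf.exists_minFits
            exact Set.mem_iUnion.2 ⟨⟨q, hm⟩, (dyadic_mono hq).1.trans hup.1,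
              hup.2.trans_le (dyadic_mono hq).2⟩
  rw [measure_iUnion hd fun p => measurableSet_Ico] at hU
  simp only [hvol] at hU
  have := ENNReal.hasSum_toReal (hU.trans_ne ENNReal.ofReal_ne_top)
  rw [← ENNReal.tsum_toReal_eq (fun p => ENNReal.ofReal_ne_top), hU,
    ENNReal.toReal_ofReal (nonneg z)] at this
  simpa only [ENNReal.toReal_ofReal (inv_nonneg.2 (pow_nonneg zero_le_two _))] using this

end Semimeasure

/-! ### A monotone machine from a stack program -/

/-- Instructions of a program with stacks, an input tape and an output tape. -/
inductive ControlInstr (S : Type) : Type where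
  | stack (c : StackInstr S)
  | read (next : Bool → S)
  | print (b : Bool) (next : S)

/-- The tape that holds a stack, with its head at the top. -/
def stackTape (l : List Bool) : Turing.Tape (Option Bool) :=
  ⟨l.head?, Turing.ListBlank.mk (l.tail.map some), Turing.ListBlank.mk []⟩

theorem listBlank_mk_none :
    Turing.ListBlank.mk [(none : Option Bool)] = Turing.ListBlank.mk [] :=
  Turing.ListBlank.cons_head_tail (Turing.ListBlank.mk ([] : List (Option Bool)))

/-- Erasing the popped symbol keeps the tape blank to the right of the head, so the stack determines
the tape. -/
theorem stackTape_pop (l : List Bool) :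
    ((stackTape l).write none).move .left = stackTape l.tail := by
  rcases l with _ | ⟨a, _ | ⟨b, l⟩⟩ <;>
    simp [stackTape, Turing.Tape.write, Turing.Tape.move, listBlank_mk_none] <;> rfl

theorem stackTape_push (b : Bool) (l : List Bool) :
    (((stackTape l).write l.head?).move .right).write (some b) = stackTape (b :: l) := by
  rcases l with _ | ⟨a, l⟩ <;>
    simp [stackTape, Turing.Tape.write, Turing.Tape.move, listBlank_mk_none]

theorem stackTape_nil : stackTape [] = default := rfl

/-- The machine that executes a program with `N` stacks; a push takes two steps. -/
def ControlInstr.machine {S : Type} [Finite S] (code : S → ControlInstr S) (start : S) (N : ℕ) :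
    MonotoneTM Bool where
  State := S ⊕ S
  finite_state := inferInstance
  k := N
  start := Sum.inl start
  δ
    | Sum.inl q, h => match code q with
      | .stack (.pop i f) => .work (fun j => if j = i then none else h j)
          (fun j => if j = i then some .left else none)
          (Sum.inl (f (if hi : i < N then h ⟨i, hi⟩ else none)))
      | .stack (.push i _ _) => .work h (fun j => if j = i then some .right else none) (Sum.inr q)
      | .stack (.skip q') => .work h (fun _ => none) (Sum.inl q')
      | .read f => .read fun b => Sum.inl (f b)
      | .print b q' => .print b (Sum.inl q')
    | Sum.inr q, h => match code q with
      | .stack (.push i b q') => .work (fun j => if j = i then some b else h j) (fun _ => none)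
          (Sum.inl q')
      -- Never reached: the second copy of a state is entered only in the middle of a push.
      | _ => .halt

namespace MonotoneTM

/-- From `c`, the machine reaches `c'` within `t` steps, without reading or printing. -/
def Quiet {T : MonotoneTM Bool} (c c' : T.Cfg) (t : ℕ) : Prop :=
  step^[t] c = c' ∧ ∀ r ≤ t, (step^[r] c).input = c.input ∧ (step^[r] c).output = c.output

theorem Quiet.trans {T : MonotoneTM Bool} {c c' c'' : T.Cfg} {t t' : ℕ} (h : Quiet c c' t)
    (h' : Quiet c' c'' t') : Quiet c c'' (t' + t) := by
  obtain ⟨rfl, h⟩ := h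
  refine ⟨by rw [Function.iterate_add_apply, h'.1], fun r hr => ?_⟩
  rcases le_total r t with hrt | hrt
  · exact h r hrt
  · obtain ⟨r, rfl⟩ := Nat.exists_eq_add_of_le' hrt
    rw [Function.iterate_add_apply, (h'.2 r (by omega)).1, (h'.2 r (by omega)).2]
    exact h t le_rfl

theorem Quiet.one {T : MonotoneTM Bool} {c c' : T.Cfg} (h : step c = c') (hi : c'.input = c.input)
    (ho : c'.output = c.output) : Quiet c c' 1 := by
  subst h
  refine ⟨rfl, fun r hr => ?_⟩
  rcases Nat.le_one_iff_eq_zero_or_eq_one.1 hr with rfl | rfl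
  · exact ⟨rfl, rfl⟩
  · exact ⟨hi, ho⟩

section Machine

variable {S : Type} [Finite S] (code : S → ControlInstr S) (start : S) (N : ℕ)

/-- The configuration of the machine that executes a program. -/
def stackCfg (q : S) (s : Regs) (inp out : List Bool) : (ControlInstr.machine code start N).Cfg :=
  ⟨Sum.inl q, fun i => stackTape (s i), inp, out⟩

variable {code start N}

theorem quiet_stack {q : S} {c : StackInstr S} (hc : code q = .stack c) (hN : c.index < N)
    (s : Regs) (inp out : List Bool) : ∃ t ≤ 2, 1 ≤ t ∧ Quiet (stackCfg code start N q s inp out)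
      (stackCfg code start N (c.exec s).1 (c.exec s).2 inp out) t := by
  rcases c with ⟨i, f⟩ | ⟨i, b, q'⟩ | q'
  · refine ⟨1, by omega, le_rfl, .one ?_ rfl rfl⟩
    have hi : i < N := hN
    simp only [step, action, stackCfg, ControlInstr.machine, hc, hi, dif_pos]
    congr 1
    funext j
    simp only [StackInstr.exec]
    by_cases hj : (j : ℕ) = i
    · simp only [hj, if_true, moveHead, Function.update_self]
      exact stackTape_pop _
    · simp only [hj, if_false, moveHead, Function.update_of_ne (β := fun _ => List Bool) hj]
      rfl
  · have hi : i < N := hN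
    let c' : (ControlInstr.machine code start N).Cfg := ⟨Sum.inr q, fun j => if (j : ℕ) = i then
      (stackTape (s j)).move .right else stackTape (s j), inp, out⟩
    have h₁ : step (stackCfg code start N q s inp out) = c' := by
      simp only [step, action, stackCfg, ControlInstr.machine, hc, c']
      congr 1
      funext j
      by_cases hj : (j : ℕ) = i
      · simp only [hj, if_true, moveHead]
        rfl
      · simp only [hj, if_false, moveHead]
        rfl
    have h₂ : step c' = stackCfg code start N q' (Function.update s i (b :: s i)) inp out := by
      simp only [step, action, stackCfg, ControlInstr.machine, hc, c']
      congr 1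
      funext j
      by_cases hj : (j : ℕ) = i
      · simp only [hj, if_true, moveHead, Function.update_self]
        exact stackTape_push _ _
      · simp only [hj, if_false, moveHead, Function.update_of_ne (β := fun _ => List Bool) hj]
        rfl
    exact ⟨2, le_rfl, by omega, (Quiet.one h₁ rfl rfl).trans (.one h₂ rfl rfl)⟩
  · refine ⟨1, by omega, le_rfl, .one ?_ rfl rfl⟩
    simp only [step, action, stackCfg, ControlInstr.machine, hc, StackInstr.exec]
    rfl

theorem step_print {q q' : S} {b : Bool} (hc : code q = .print b q') (s : Regs)
    (inp out : List Bool) : step (stackCfg code start N q s inp out) =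
      stackCfg code start N q' s inp (out ++ [b]) := by
  simp only [step, action, stackCfg, ControlInstr.machine, hc]

theorem step_read_cons {q : S} {f : Bool → S} (hc : code q = .read f) (s : Regs) (b : Bool)
    (inp out : List Bool) : step (stackCfg code start N q s (b :: inp) out) =
      stackCfg code start N (f b) s inp out := by
  simp only [step, action, stackCfg, ControlInstr.machine, hc]

theorem step_read_nil {q : S} {f : Bool → S} (hc : code q = .read f) (s : Regs)
    (out : List Bool) : step (stackCfg code start N q s [] out) =
      stackCfg code start N q s [] out := by
  simp only [step, action, stackCfg, ControlInstr.machine, hc]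

end Machine

/-! ### The main loop of the decoder -/

/-- The states of the main loop of a decoder outside the computation of the next bit. -/
inductive LoopState : Type where
  | test
  | print (b : Bool)
  | pushOut (b : Bool)
  | read
  | pushIn (b : Bool)
  deriving DecidableEq, Fintype

/-- The program that repeatedly computes the next output bit from the input and the output so far
by the program `F`, and reads a bit if there is none. -/
def loopCode (F : StackProg Unit) : F.State ⊕ LoopState → ControlInstr (F.State ⊕ LoopState)
  | Sum.inl q => .stack ((F.code q).map (Sum.map id fun _ => .test))
  | Sum.inr .test => .stack (.pop 2 fun o => Sum.inr (o.elim .read .print))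
  | Sum.inr (.print b) => .print b (Sum.inr (.pushOut b))
  | Sum.inr (.pushOut b) => .stack (.push 1 b (Sum.inl F.start))
  | Sum.inr .read => .read fun b => Sum.inr (.pushIn b)
  | Sum.inr (.pushIn b) => .stack (.push 0 b (Sum.inl F.start))

/-- The stacks hold the given input and output in reverse. -/
def loopRegs (p y : List Bool) : Regs :=
  Function.update (Function.update (fun _ => []) 0 p) 1 y

/-- `T` decodes its input by the function `next`, which yields the next output bit if there is one:
the configuration `R p y w` is entered with input `p` read, `y` printed and `w` left to read, where
`p` and `y` are in reverse. -/
structure Decodes (T : MonotoneTM Bool) (next : List Bool → List Bool → List Bool)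
    (R : List Bool → List Bool → List Bool → T.Cfg) (B : Polynomial ℕ) : Prop where
  init : ∀ w, R [] [] w = T.init w
  input : ∀ p y w, (R p y w).input = w
  output : ∀ p y w, (R p y w).output = y.reverse
  print : ∀ p y w b, next p y = [b] → ∃ t ≤ B.eval (p.length + y.length), 1 ≤ t ∧
    step^[t] (R p y w) = R p (b :: y) w ∧ ∀ r < t, (step^[r] (R p y w)).input = w ∧
      ((step^[r] (R p y w)).output = y.reverse ∨ (step^[r] (R p y w)).output = (b :: y).reverse)
  read : ∀ p y w b, next p y = [] → ∃ t ≤ B.eval (p.length + y.length), 1 ≤ t ∧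
    step^[t] (R p y (b :: w)) = R (b :: p) y w ∧
      ∀ r < t, (step^[r] (R p y (b :: w))).output = y.reverse
  stuck : ∀ p y, next p y = [] → ∀ r, (step^[r] (R p y [])).output = y.reverse

theorem quiet_loop {F : StackProg Unit} {N : ℕ} (hN : ∀ q, (F.code q).index < N) [Finite F.State]
    {q s u s' t} (h : F.Run q s u s' t) (inp out : List Bool) : ∃ t' ≤ 2 * t, 1 ≤ t' ∧ Quiet
      (stackCfg (loopCode F) (Sum.inl F.start) N (Sum.inl q) s inp out)
      (stackCfg (loopCode F) (Sum.inl F.start) N (Sum.inr .test) s' inp out) t' := by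
  have hidx : ∀ q, ((F.code q).map (Sum.map id fun _ => LoopState.test)).index < N := by
    intro q
    have := hN q
    rcases h : F.code q <;> simpa [h, StackInstr.map, StackInstr.index] using this
  induction h with
  | @exit q s b s' h =>
    obtain ⟨t, ht, ht', hq⟩ := quiet_stack (code := loopCode F) (start := Sum.inl F.start)
      (q := Sum.inl q) rfl (hidx q) s inp out
    rw [StackInstr.exec_map, h] at hq
    exact ⟨t, by omega, ht', hq⟩
  | @step q s q' s' b s'' t h _ ih =>
    obtain ⟨t₁, ht₁, ht₁', hq⟩ := quiet_stack (code := loopCode F) (start := Sum.inl F.start)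
      (q := Sum.inl q) rfl (hidx q) s inp out
    rw [StackInstr.exec_map, h] at hq
    obtain ⟨t₂, ht₂, ht₂', hq'⟩ := ih
    exact ⟨t₂ + t₁, by omega, by omega, hq.trans hq'⟩

theorem exists_decodes {next : List Bool → List Bool → List Bool}
    (h : PolyTime fun v : Fin 2 → List Bool => next (v 0) (v 1)) :
    ∃ T R B, Decodes T next R B := by
  obtain ⟨P, F, hF⟩ := h
  have := F.finite_state
  obtain ⟨N₀, hN₀⟩ := (Set.finite_range fun q => (F.code q).index).bddAbove
  -- Finitely many states use finitely many stacks; the loop itself needs stacks 0 to 2.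
  set N := max (N₀ + 1) 3 with hNdef
  have hN : ∀ q, (F.code q).index < N := fun q =>
    (Nat.lt_succ_of_le (hN₀ ⟨q, rfl⟩)).trans_le (le_max_left _ _)
  have hN3 : 3 ≤ N := le_max_right _ _
  set cfg := stackCfg (loopCode F) (Sum.inl F.start) N with hcfg
  have compute : ∀ p y w, ∃ t ≤ 2 * P.eval (p.length + y.length) + 2, 1 ≤ t ∧
      Quiet (cfg (Sum.inl F.start) (loopRegs p y) w y.reverse)
        (cfg (Sum.inr ((next p y).head?.elim .read .print))
          (Function.update (loopRegs p y) 2 (next p y).tail) w y.reverse) t := by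
    intro p y w
    obtain ⟨t, ht, hr⟩ := hF (loopRegs p y) () _ _ ⟨fun i hi => by
      rw [loopRegs, Function.update_of_ne (by omega), Function.update_of_ne (by omega)], rfl, rfl⟩
    obtain ⟨t₁, ht₁, ht₁', hq⟩ := quiet_loop hN hr w y.reverse
    obtain ⟨t₂, ht₂, ht₂', hq'⟩ := quiet_stack (code := loopCode F) (start := Sum.inl F.start)
      (N := N) (q := Sum.inr .test) rfl (show 2 < N by omega)
      (Function.update (loopRegs p y) 2 (next p y)) w y.reverse
    have h0 : loopRegs p y 0 = p := by simp [loopRegs]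
    have h1 : loopRegs p y 1 = y := by simp [loopRegs]
    simp only [totalLength, Fin.sum_univ_two, Fin.val_zero, Fin.val_one, h0, h1] at ht hq
    simp only [StackInstr.exec, Function.update_self, Function.update_idem] at hq'
    exact ⟨t₂ + t₁, by omega, by omega, hq.trans hq'⟩
  -- A result of at most one bit is gone once the test has popped it, so the next round starts with
  -- clean stacks.
  have clean : ∀ p y, Function.update (loopRegs p y) 2 [] = loopRegs p y := fun p y => by
    rw [Function.update_eq_self_iff]
    simp [loopRegs]
  refine ⟨ControlInstr.machine (loopCode F) (Sum.inl F.start) N,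
    -- Two machine steps per stack instruction, at most 2 for the test, 1 to print or read, at most
    -- 2 to record the bit.
    fun p y w => cfg (Sum.inl F.start) (loopRegs p y) w y.reverse, 2 * P + 5, ?_, ?_, ?_, ?_, ?_, ?_⟩
  · intro w
    simp only [hcfg, stackCfg, MonotoneTM.init, List.reverse_nil]
    congr 1
    funext i
    simp [loopRegs, stackTape_nil]
  · exact fun p y w => rfl
  · exact fun p y w => rfl
  · intro p y w b hb
    obtain ⟨t₁, ht₁, ht₁', hq₁⟩ := compute p y w
    rw [hb, List.tail_cons, List.head?_cons, clean] at hq₁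
    have hpr : step (cfg (Sum.inr (.print b)) (loopRegs p y) w y.reverse) =
        cfg (Sum.inr (.pushOut b)) (loopRegs p y) w (b :: y).reverse := by
      rw [List.reverse_cons]
      exact step_print (code := loopCode F) (q := Sum.inr (.print b)) rfl _ _ _
    obtain ⟨t₂, ht₂, ht₂', hq₂⟩ := quiet_stack (code := loopCode F) (start := Sum.inl F.start)
      (N := N) (q := Sum.inr (.pushOut b)) rfl (show 1 < N by omega) (loopRegs p y) w (b :: y).reverse
    have hregs : Function.update (loopRegs p y) 1 (b :: loopRegs p y 1) = loopRegs p (b :: y) := by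
      simp [loopRegs]
    simp only [StackInstr.exec, hregs] at hq₂
    have hfull : step^[t₁ + 1] (cfg (Sum.inl F.start) (loopRegs p y) w y.reverse) =
        cfg (Sum.inr (.pushOut b)) (loopRegs p y) w (b :: y).reverse := by
      rw [Function.iterate_succ_apply', hq₁.1]
      exact hpr
    refine ⟨t₂ + (t₁ + 1), by simp; omega, by omega, ?_, fun r hr => ?_⟩
    · rw [Function.iterate_add_apply, hfull]
      exact hq₂.1
    · rcases Nat.lt_or_ge r (t₁ + 1) with h | h
      · exact ⟨(hq₁.2 r (by omega)).1, Or.inl (hq₁.2 r (by omega)).2⟩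
      · obtain ⟨r, rfl⟩ := Nat.exists_eq_add_of_le' h
        rw [Function.iterate_add_apply, hfull]
        exact ⟨(hq₂.2 r (by omega)).1, Or.inr (hq₂.2 r (by omega)).2⟩
  · intro p y w b hb
    obtain ⟨t₁, ht₁, ht₁', hq₁⟩ := compute p y (b :: w)
    rw [hb, List.tail_nil, List.head?_nil, clean] at hq₁
    have hrd : step (cfg (Sum.inr .read) (loopRegs p y) (b :: w) y.reverse) =
        cfg (Sum.inr (.pushIn b)) (loopRegs p y) w y.reverse :=
      step_read_cons (code := loopCode F) (q := Sum.inr .read) rfl _ _ _ _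
    obtain ⟨t₂, ht₂, ht₂', hq₂⟩ := quiet_stack (code := loopCode F) (start := Sum.inl F.start)
      (N := N) (q := Sum.inr (.pushIn b)) rfl (show 0 < N by omega) (loopRegs p y) w y.reverse
    have hregs : Function.update (loopRegs p y) 0 (b :: loopRegs p y 0) = loopRegs (b :: p) y := by
      rw [loopRegs, loopRegs, Function.update_comm (by omega)]
      simp
    simp only [StackInstr.exec, hregs] at hq₂
    have hfull : step^[t₁ + 1] (cfg (Sum.inl F.start) (loopRegs p y) (b :: w) y.reverse) =
        cfg (Sum.inr (.pushIn b)) (loopRegs p y) w y.reverse := by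
      rw [Function.iterate_succ_apply', hq₁.1]
      exact hrd
    refine ⟨t₂ + (t₁ + 1), by simp; omega, by omega, ?_, fun r hr => ?_⟩
    · rw [Function.iterate_add_apply, hfull]
      exact hq₂.1
    · rcases Nat.lt_or_ge r (t₁ + 1) with h | h
      · exact (hq₁.2 r (by omega)).2
      · obtain ⟨r, rfl⟩ := Nat.exists_eq_add_of_le' h
        rw [Function.iterate_add_apply, hfull]
        exact (hq₂.2 r (by omega)).2
  · intro p y hb r
    obtain ⟨t₁, ht₁, ht₁', hq₁⟩ := compute p y []
    rw [hb, List.tail_nil, List.head?_nil, clean] at hq₁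
    have hst : step (cfg (Sum.inr .read) (loopRegs p y) [] y.reverse) =
        cfg (Sum.inr .read) (loopRegs p y) [] y.reverse :=
      step_read_nil (code := loopCode F) (q := Sum.inr .read) rfl _ _
    rcases Nat.le_or_ge r t₁ with h | h
    · exact (hq₁.2 r h).2
    · obtain ⟨r, rfl⟩ := Nat.exists_eq_add_of_le' h
      rw [Function.iterate_add_apply, hq₁.1]
      exact congrArg Cfg.output (Function.iterate_fixed hst r)

end MonotoneTM

/-! ### The programs of a greedy decoder -/

namespace MonotoneTM

/-- Started in `c`, the output is `x` for the first time after `t` steps, and then the whole input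
has been read. -/
def ComputesFrom {T : MonotoneTM Bool} (c : T.Cfg) (x : List Bool) (t : ℕ) : Prop :=
  (step^[t] c).output = x ∧ (∀ s < t, (step^[s] c).output ≠ x) ∧ (step^[t] c).input = []

theorem ComputesFrom.eq {T : MonotoneTM Bool} {c : T.Cfg} {x : List Bool} {t t' : ℕ}
    (h : ComputesFrom c x t) (h' : ComputesFrom c x t') : t = t' := by
  rcases lt_trichotomy t t' with hlt | rfl | hlt
  · exact absurd h.1 (h'.2.1 t hlt)
  · rfl
  · exact absurd h'.1 (h.2.1 t' hlt)

theorem ComputesFrom.of_iterate {T : MonotoneTM Bool} {c : T.Cfg} {x : List Bool} {t t' : ℕ}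
    (h : ComputesFrom (step^[t] c) x t') (ht : ∀ s < t, (step^[s] c).output ≠ x) :
    ComputesFrom c x (t' + t) := by
  refine ⟨by rw [Function.iterate_add_apply]; exact h.1, fun s hs => ?_,
    by rw [Function.iterate_add_apply]; exact h.2.2⟩
  rcases Nat.lt_or_ge s t with hst | hst
  · exact ht s hst
  · obtain ⟨s, rfl⟩ := Nat.exists_eq_add_of_le' hst
    rw [Function.iterate_add_apply]
    exact h.2.1 s (by omega)

theorem ComputesFrom.iterate {T : MonotoneTM Bool} {c : T.Cfg} {x : List Bool} {t t' : ℕ}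
    (h : ComputesFrom c x (t' + t)) : ComputesFrom (step^[t] c) x t' := by
  refine ⟨by rw [← Function.iterate_add_apply]; exact h.1, fun s hs => ?_,
    by rw [← Function.iterate_add_apply]; exact h.2.2⟩
  rw [← Function.iterate_add_apply]
  exact h.2.1 _ (by omega)

theorem output_prefix_step {T : MonotoneTM Bool} (c : T.Cfg) : c.output <+: (step c).output := by
  unfold step
  split
  · exact List.prefix_rfl
  · split <;> exact List.prefix_rfl
  · exact List.prefix_append _ _
  · exact List.prefix_rfl

theorem output_prefix_iterate {T : MonotoneTM Bool} (c : T.Cfg) (t : ℕ) :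
    c.output <+: (step^[t] c).output := by
  induction t with
  | zero => exact List.prefix_rfl
  | succ t ih =>
    rw [Function.iterate_succ_apply']
    exact ih.trans (output_prefix_step _)

theorem exists_cons_suffix {y z : List Bool} (h : y <:+ z) (hne : y ≠ z) : ∃ b, b :: y <:+ z := by
  obtain ⟨r, rfl⟩ := h
  rcases List.eq_nil_or_concat r with rfl | ⟨r, b, rfl⟩
  · exact absurd rfl hne
  · exact ⟨b, r, by simp⟩

section Decoding

variable {T : MonotoneTM Bool} {next : List Bool → List Bool → List Bool}
  {R : List Bool → List Bool → List Bool → T.Cfg} {B : Polynomial ℕ} {μ : List Bool → ℝ}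

open Classical in
/-- `next` is the greedy decoder for `μ`. -/
def IsGreedy (μ : List Bool → ℝ) (next : List Bool → List Bool → List Bool) : Prop :=
  ∀ p y, next p y =
    if Fits μ p (false :: y) then [false] else if Fits μ p (true :: y) then [true] else []

theorem IsGreedy.cases (hn : IsGreedy μ next) (p y : List Bool) :
    (∃ b, next p y = [b] ∧ Fits μ p (b :: y)) ∨ (next p y = [] ∧ ∀ b, ¬ Fits μ p (b :: y)) := by
  classical
  rw [hn p y]
  split_ifs with h1 h2
  · exact Or.inl ⟨_, rfl, h1⟩
  · exact Or.inl ⟨_, rfl, h2⟩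
  · exact Or.inr ⟨rfl, fun b => by cases b <;> assumption⟩

variable (hT : Decodes T next R B) (hn : IsGreedy μ next) (nonneg : ∀ z, 0 ≤ μ z)
  (add_le : ∀ z, μ (false :: z) + μ (true :: z) ≤ μ z)

include hT hn nonneg add_le

omit hT hn in
theorem not_fits_of_next {p y z : List Bool} (h : ∀ b, ¬ Fits μ p (b :: y)) (hy : y <:+ z)
    (hne : y ≠ z) : ¬ Fits μ p z := by
  intro hf
  obtain ⟨b, hb⟩ := exists_cons_suffix hy hne
  exact h b (hf.of_suffix_right nonneg add_le hb)

/-- Every round reads or prints, so `n`, the number of symbols still to be read or printed, drops. A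
printed bit is correct by the chain property; when `z` is complete, minimality leaves nothing
unread; and no bit is missing earlier, since the full program fits `z`. -/
theorem computesFrom_of_minFits {N : ℕ} {z : List Bool} (n : ℕ) :
    ∀ p y w, w.length + (z.length - y.length) = n → p.length + w.length + z.length ≤ N →
      MinFits μ (w.reverse ++ p) z → y <:+ z → y ≠ z →
      ∃ t ≤ n * B.eval N, ComputesFrom (R p y w) z.reverse t := by
  induction n with
  | zero =>
    intro p y w h _ _ hy hne
    exact absurd (hy.eq_of_length (by have := hy.length_le; omega)) hne
  | succ n ih =>
    intro p y w hlen hN hm hy hne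
    have hyl : y.length < z.length :=
      lt_of_le_of_ne hy.length_le fun h => hne (hy.eq_of_length h)
    have hB : B.eval (p.length + y.length) ≤ B.eval N := B.eval_mono_nat (by omega)
    rw [add_mul, one_mul]
    rcases hn.cases p y with ⟨b, hb, hf⟩ | ⟨hnil, hnf⟩
    · obtain ⟨t, ht, ht1, hst, hbefore⟩ := hT.print p y w b hb
      have hz : b :: y <:+ z := Fits.suffix_or_suffix nonneg add_le
        (hf.of_suffix_left (List.suffix_append _ _)) hm.1 hyl
      by_cases hbz : b :: y = z
      · have hw : w = [] := by
          have := hm.2 p (List.suffix_append _ _) (hbz ▸ hf)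
          simpa using this
        have hout : (step^[t] (R p y w)).output = z.reverse := by
          rw [hst, hT.output, hbz]
        classical
        -- The output is complete before the round ends, as the bit has yet to be pushed on its
        -- stack; hence the first such moment.
        have hex : ∃ t, (step^[t] (R p y w)).output = z.reverse := ⟨t, hout⟩
        have hle : Nat.find hex ≤ t := Nat.find_min' hex hout
        refine ⟨Nat.find hex, by omega, Nat.find_spec hex, fun s hs => Nat.find_min hex hs, ?_⟩
        rcases hle.lt_or_eq with h | h
        · rw [(hbefore _ h).1, hw]
        · rw [h, hst, hT.input, hw]
      · obtain ⟨t', ht', hc⟩ := ih p (b :: y) w (by simp; omega) hN hm hz hbz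
        refine ⟨t' + t, by omega, ComputesFrom.of_iterate (hst ▸ hc) fun s hs => ?_⟩
        rcases (hbefore s hs).2 with h | h
        · rw [h]
          exact fun h => hne (List.reverse_injective h)
        · rw [h]
          exact fun h => hbz (List.reverse_injective h)
    · have hnz := not_fits_of_next nonneg add_le hnf hy hne
      rcases w with _ | ⟨b, w⟩
      · exact absurd hm.1 hnz
      · obtain ⟨t, ht, ht1, hst, hbefore⟩ := hT.read p y w b hnil
        simp only [List.length_cons] at hlen hN
        obtain ⟨t', ht', hc⟩ := ih (b :: p) y w (by omega) (by simp; omega)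
          (by simpa using hm) hy hne
        refine ⟨t' + t, by omega, ComputesFrom.of_iterate (hst ▸ hc) fun s hs => ?_⟩
        rw [hbefore s hs]
        exact fun h => hne (List.reverse_injective h)

/-- The invariant says that no shorter part of the input fits `z`. It survives a read, because the
decoder reads only when `p` fits no proper extension of `y`, in particular not `z`. -/
theorem minFits_of_computesFrom {z : List Bool} (t : ℕ) :
    ∀ p y w, ComputesFrom (R p y w) z.reverse t → y <:+ z → y ≠ z →
      (∀ q, q <:+ p → Fits μ q z → q = p) → MinFits μ (w.reverse ++ p) z := by
  induction t using Nat.strong_induction_on with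
  | _ t ih =>
  intro p y w hc hy hne hmin
  rcases hn.cases p y with ⟨b, hb, hf⟩ | ⟨hnil, hnf⟩
  · obtain ⟨T', -, ht1, hst, hbefore⟩ := hT.print p y w b hb
    have finish : b :: y = z → w = [] → MinFits μ (w.reverse ++ p) z := by
      rintro rfl rfl
      exact ⟨hf, hmin⟩
    rcases Nat.lt_or_ge t T' with h | h
    · obtain ⟨h1, h2⟩ := hbefore t h
      rw [hc.1] at h2
      rw [hc.2.2] at h1
      rcases h2 with h2 | h2
      · exact absurd (List.reverse_injective h2).symm hne
      · exact finish (List.reverse_injective h2).symm h1.symm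
    · obtain ⟨t, rfl⟩ := Nat.exists_eq_add_of_le' h
      have hc' := hc.iterate
      rw [hst] at hc'
      by_cases hbz : b :: y = z
      · rcases Nat.eq_zero_or_pos t with rfl | hpos
        · exact finish hbz ((hT.input _ _ _).symm.trans hc'.2.2)
        · exact absurd (by rw [← hbz]; exact hT.output _ _ _) (hc'.2.1 0 hpos)
      · refine ih t (by omega) p (b :: y) w hc' ?_ hbz hmin
        -- Output is never erased, so the printed bit must belong to the target.
        have := output_prefix_iterate (R p (b :: y) w) t
        rw [hc'.1, hT.output] at this
        exact List.reverse_prefix.1 this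
  · have hnz := not_fits_of_next nonneg add_le hnf hy hne
    have hout : z.reverse ≠ y.reverse := fun h => hne (List.reverse_injective h).symm
    rcases w with _ | ⟨b, w⟩
    · exact absurd (hc.1.symm.trans (hT.stuck p y hnil t)) hout
    · obtain ⟨T', -, ht1, hst, hbefore⟩ := hT.read p y w b hnil
      rcases Nat.lt_or_ge t T' with h | h
      · exact absurd (hc.1.symm.trans (hbefore t h)) hout
      · obtain ⟨t, rfl⟩ := Nat.exists_eq_add_of_le' h
        have hc' := hc.iterate
        rw [hst] at hc'
        have := ih t (by omega) (b :: p) y w hc' hy hne fun q hq hqz => by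
          rcases List.suffix_cons_iff.1 hq with rfl | hq
          · rfl
          · exact absurd (hqz.of_suffix_left hq) hnz
        simpa using this

theorem computes_iff_minFits {p x : List Bool} (hx : x ≠ []) :
    T.Computes p x ↔ MinFits μ p.reverse x.reverse := by
  have hx' : [] ≠ x.reverse := by simpa using hx.symm
  constructor
  · rintro ⟨t, ht⟩
    have := minFits_of_computesFrom hT hn nonneg add_le (z := x.reverse) t [] [] p (by
      rw [hT.init, List.reverse_reverse]; exact ht) List.nil_suffix hx'
      fun q hq _ => List.suffix_nil.1 hq
    simpa using this
  · intro h
    obtain ⟨t, -, ht⟩ := computesFrom_of_minFits hT hn nonneg add_le (z := x.reverse) _ [] [] p rfl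
      le_rfl (by simpa using h) List.nil_suffix hx'
    rw [hT.init, List.reverse_reverse] at ht
    exact ⟨t, ht⟩

theorem time_le {p x : List Bool} (hx : x ≠ []) {t : ℕ} (ht : T.ComputesAt p x t) :
    t ≤ (p.length + x.length) * B.eval (p.length + x.length) := by
  have hx' : [] ≠ x.reverse := by simpa using hx.symm
  obtain ⟨t', ht', hc⟩ := computesFrom_of_minFits hT hn nonneg add_le (z := x.reverse)
    (N := p.length + x.length) _ [] [] p rfl (by simp)
    (by simpa using (computes_iff_minFits hT hn nonneg add_le hx).1 ⟨t, ht⟩) List.nil_suffix hx'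
  rw [hT.init, List.reverse_reverse] at hc
  rw [ComputesFrom.eq ht hc]
  simpa using ht'

end Decoding

theorem ComputesAt.eq_zero_of_nil {T : MonotoneTM Bool} {p : List Bool} {t : ℕ}
    (h : T.ComputesAt p [] t) : t = 0 := by
  by_contra ht
  exact h.2.1 0 (Nat.pos_of_ne_zero ht) rfl

theorem computes_nil_iff {T : MonotoneTM Bool} {p : List Bool} : T.Computes p [] ↔ p = [] := by
  constructor
  · rintro ⟨t, ht⟩
    obtain rfl := ht.eq_zero_of_nil
    exact ht.2.2
  · rintro rfl
    exact ⟨0, rfl, fun s hs => absurd hs (Nat.not_lt_zero s), rfl⟩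

theorem Computes.km_le {T : MonotoneTM Bool} {p x : List Bool} (h : T.Computes p x) :
    T.Km x ≤ p.length :=
  iInf₂_le p h

end MonotoneTM

theorem twoPowNeg_nonneg (k : ℕ∞) : 0 ≤ twoPowNeg k := by
  induction k using ENat.recTopCoe with
  | top => exact le_rfl
  | coe n => exact zpow_nonneg zero_le_two _

theorem inv_two_pow_le_twoPowNeg {k : ℕ∞} {n : ℕ} (h : k ≤ n) :
    ((2 : ℝ) ^ n)⁻¹ ≤ twoPowNeg k := by
  lift k to ℕ using ne_top_of_le_ne_top (ENat.natCast_ne_top n) h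
  have hk : k ≤ n := by exact_mod_cast h
  change _ ≤ (2 : ℝ) ^ (-(k : ℤ))
  rw [zpow_neg, zpow_natCast]
  gcongr
  norm_num

/-! ### Numerators and denominators -/

theorem PolyTime.reverse : PolyTime fun v : Fin 1 → List Bool => (v 0).reverse := by
  refine of_erasing ⟨9 * Polynomial.X + 6, ((Impl.moveRev (i := 0) (j := 1) (by omega)).seq
    ((Impl.moveRev (i := 1) (j := 2) (by omega)).seq
      (Impl.moveRev (i := 2) (j := 0) (by omega)))).mono ?_⟩
  rintro s ⟨⟩ s' t ⟨hs, rfl, rfl⟩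
  have h1 := hs 1 le_rfl
  have h2 := hs 2 (by omega)
  refine ⟨_, ?_, _, _, _, ⟨rfl, rfl⟩, ⟨_, _, _, ⟨rfl, rfl⟩, ⟨?_, rfl⟩, rfl⟩, rfl⟩
  · simp [totalLength, h1, h2]
    omega
  · funext i
    rcases eq_or_ne i 0 with rfl | h0
    · simp [h1, h2]
    · have hi := hs i (by omega)
      simp only [Function.update_apply, h0, if_false]
      split_ifs <;> first | rfl | exact hi.symm

theorem exists_polyTime_num_den {codeStr : List Bool → List Bool} {codeNat : ℕ → List Bool}
    (hStr : IsPolyTimePrefixCode id codeStr) (hNat : IsPolyTimePrefixCode Nat.bits codeNat)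
    {ν : List Bool → ℝ} (hc : FinitelyComputableInPolyTime codeStr codeNat ν) :
    ∃ num den : List Bool → List Bool, PolyTime (fun v : Fin 1 → List Bool => num (v 0)) ∧
      PolyTime (fun v : Fin 1 → List Bool => den (v 0)) ∧
      ∀ z, 0 < binVal (den z) ∧ ν z.reverse = (binVal (num z) : ℝ) / binVal (den z) := by
  obtain ⟨M, q, hM⟩ := hc
  choose m n hn hmn hrun using hM
  obtain ⟨E, qE, hE⟩ := hStr.computable
  obtain ⟨D, qD, hD⟩ := hNat.decodable
  have h1 : PolyTime fun v : Fin 1 → List Bool => codeStr (v 0).reverse := by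
    -- An empty input stack is read as the end marker `none`; the second alternative of `I` covers
    -- the situation after the marker has been read.
    refine PolyTime.of_haltsAt E PolyTime.reverse (conv := some)
      (I := fun w l => w = l.map some ++ [none] ∨ w = []) ?_ (fun v => Or.inl rfl) qE fun v => ?_
    · rintro a w (_ | ⟨b, l⟩) (h | h)
      · simp at h
        simp [h]
      · simp at h
      · simp at h
        simp [h]
      · simp at h
    · simpa [totalLength] using hE (v 0).reverse
  have h2 : PolyTime fun v : Fin 1 → List Bool =>
      codeNat (m (v 0).reverse) ++ codeNat (n (v 0).reverse) := by
    refine PolyTime.of_haltsAt M h1 (conv := id) (I := fun w l => w = l) ?_ (fun v => rfl) q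
      fun v => ?_
    · rintro a w l rfl
      simp
    · simpa [totalLength] using hrun (v 0).reverse
  have hI : ∀ a w l, (∃ r, l = a :: w ++ r) →
      id l.head? = some (a : Bool) ∧ ∃ r, l.tail = w ++ r := by
    rintro a w _ ⟨r, rfl⟩
    exact ⟨rfl, r, rfl⟩
  obtain ⟨Q, hQ⟩ := h2.exists_length_le
  -- The first code word is no longer than the concatenation, whose length `Q` bounds.
  have hD' : ∀ v : Fin 1 → List Bool, ∃ t ≤ (qD.comp Q).eval (totalLength v),
      D.HaltsAt (codeNat (m (v 0).reverse)) (m (v 0).reverse).bits t ∧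
        (D.run (codeNat (m (v 0).reverse)) t).input = [] := by
    intro v
    obtain ⟨t, ht, h⟩ := hD (m (v 0).reverse)
    refine ⟨t, ht.trans ?_, h⟩
    rw [Polynomial.eval_comp]
    refine qD.eval_mono_nat (le_trans ?_ (hQ v))
    simp
  have h3 : PolyTime fun v : Fin 1 → List Bool => (m (v 0).reverse).bits :=
    PolyTime.of_haltsAt D h2 (conv := id) (I := fun w l => ∃ r, l = w ++ r) hI
      (fun v => ⟨_, rfl⟩) (qD.comp Q) fun v => (hD' v).imp fun t ht => ⟨ht.1, ht.2.1⟩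
  have h4 : PolyTime fun v : Fin 1 → List Bool => codeNat (n (v 0).reverse) :=
    PolyTime.of_haltsAt_rest D h2 (fun v => rfl) (qD.comp Q) hD'
  obtain ⟨Q', hQ'⟩ := h4.exists_length_le
  have h5 : PolyTime fun v : Fin 1 → List Bool => (n (v 0).reverse).bits := by
    refine PolyTime.of_haltsAt D h4 (conv := id) (I := fun w l => ∃ r, l = w ++ r) hI
      (fun v => ⟨[], (List.append_nil _).symm⟩) (qD.comp Q') fun v => ?_
    obtain ⟨t, ht, h, -⟩ := hD (n (v 0).reverse)
    refine ⟨t, ht.trans ?_, h⟩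
    rw [Polynomial.eval_comp]
    exact qD.eval_mono_nat (hQ' v)
  refine ⟨fun z => (m z.reverse).bits, fun z => (n z.reverse).bits, h3, h5, fun z => ?_⟩
  rw [binVal_bits, binVal_bits]
  exact ⟨hn _, hmn _⟩

/-! ### The decoder for the given semimeasure -/

theorem mainTheorem10 (codeStr : List Bool → List Bool) (codeNat : ℕ → List Bool)
    (hStr : IsPolyTimePrefixCode id codeStr) (hNat : IsPolyTimePrefixCode Nat.bits codeNat)
    (ν : List Bool → ℝ) (hν : IsSemimeasure ν)
    (hc : FinitelyComputableInPolyTime codeStr codeNat ν) :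
    ∃ T : MonotoneTM Bool,
      (∀ x : List Bool, (x = [] → ν [] = 1) →
        HasSum (fun p : {p : List Bool // T.Computes p x} => (2 : ℝ) ^ (-(p.1.length : ℤ)))
          (ν x)) ∧
      (∀ x : List Bool, ν x / 4 ≤ twoPowNeg (T.Km x)) ∧
      (∃ (g : Polynomial ℕ) (C : ℕ), ∀ (x p : List Bool) (t : ℕ),
        T.ComputesAt p x t → (p.length : ℕ∞) = T.Km x →
          (t : ℝ) ≤ ((g.eval x.length : ℕ) : ℝ) - (C : ℝ) * Real.logb 2 (ν x)) := by
  obtain ⟨num, den, hnum, hden, hμ⟩ := exists_polyTime_num_den hStr hNat hc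
  obtain ⟨T, R, B, hT⟩ := MonotoneTM.exists_decodes (PolyTime.nextBit hnum hden)
  obtain ⟨Q, hQ⟩ := hden.exists_length_le
  set μ : List Bool → ℝ := fun z => ν z.reverse with hμdef
  have hn : MonotoneTM.IsGreedy μ (nextBit num den) := fun p y => nextBit_eq hμ p y
  have nonneg : ∀ z, 0 ≤ μ z := fun z => hν.nonneg _
  have add_le : ∀ z, μ (false :: z) + μ (true :: z) ≤ μ z := fun z => by
    simpa [hμdef] using hν.add_le z.reverse
  have nil_le : μ [] ≤ 1 := hν.nil_le_one
  have hμx : ∀ x, μ x.reverse = ν x := fun x => by simp [hμdef]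
  have hcomp : ∀ {p x : List Bool}, x ≠ [] → (T.Computes p x ↔ MinFits μ p.reverse x.reverse) :=
    fun hx => MonotoneTM.computes_iff_minFits hT hn nonneg add_le hx
  have short : ∀ {x : List Bool}, x ≠ [] → 0 < ν x →
      ∃ n : ℕ, T.Km x ≤ n ∧ ν x / 4 ≤ ((2 : ℝ) ^ n)⁻¹ := by
    intro x hx hpos
    obtain ⟨p, hp, hle⟩ := exists_minFits_le nonneg add_le nil_le (z := x.reverse)
      (by rwa [hμx])
    rw [hμx] at hle
    refine ⟨p.length, ?_, hle⟩
    have : T.Computes p.reverse x := (hcomp hx).2 (by rwa [List.reverse_reverse])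
    simpa using this.km_le
  -- Shortest programs have at most 2 + Q(|x|) bits, where `Q` bounds the length of the denominator,
  -- so |p| + |x| rounds fit into a polynomial in |x| and the logarithmic term can be dropped.
  refine ⟨T, fun x hx => ?_, fun x => ?_, (Polynomial.X + 2 + Q) * B.comp (Polynomial.X + 2 + Q), 0,
    fun x p t ht hp => ?_⟩
  · rcases eq_or_ne x [] with rfl | hne
    · rw [hx rfl]
      have : Unique {p : List Bool // T.Computes p []} :=
        ⟨⟨⟨[], MonotoneTM.computes_nil_iff.2 rfl⟩⟩,
          fun p => Subtype.ext (MonotoneTM.computes_nil_iff.1 p.2)⟩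
      convert hasSum_unique _
      rw [MonotoneTM.computes_nil_iff.1 (default : {p : List Bool // T.Computes p []}).2]
      simp
    · have hs := hasSum_minFits nonneg add_le nil_le x.reverse
      rw [hμx] at hs
      let e : {p // T.Computes p x} ≃ {p // MinFits μ p x.reverse} :=
        { toFun := fun p => ⟨p.1.reverse, (hcomp hne).1 p.2⟩
          invFun := fun p => ⟨p.1.reverse, (hcomp hne).2 (by rw [List.reverse_reverse]; exact p.2)⟩
          left_inv := fun p => Subtype.ext (List.reverse_reverse _)
          right_inv := fun p => Subtype.ext (List.reverse_reverse _) }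
      convert e.hasSum_iff.2 hs using 2 with p
      simp [e]
  · rcases eq_or_ne x [] with rfl | hne
    · have h0 : T.Km [] ≤ (0 : ℕ) := (MonotoneTM.computes_nil_iff (T := T).2 rfl).km_le
      have := inv_two_pow_le_twoPowNeg h0
      have := hν.nil_le_one
      norm_num at *
      linarith
    · rcases (hν.nonneg x).eq_or_lt with h0 | hpos
      · rw [← h0, zero_div]
        exact twoPowNeg_nonneg _
      · obtain ⟨n, hn, hle⟩ := short hne hpos
        exact hle.trans (inv_two_pow_le_twoPowNeg hn)
  · rw [Nat.cast_zero, zero_mul, sub_zero, Nat.cast_le]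
    rcases eq_or_ne x [] with rfl | hne
    · rw [ht.eq_zero_of_nil]
      exact Nat.zero_le _
    · have hm := (hcomp hne).1 ⟨t, ht⟩
      have hpos : 0 < ν x := hμx x ▸ hm.1.pos
      obtain ⟨n, hn', hle⟩ := short hne hpos
      have hpn : p.length ≤ n := by
        rw [← hp] at hn'
        exact_mod_cast hn'
      have hden_pos : (0 : ℝ) < binVal (den x.reverse) := by exact_mod_cast (hμ x.reverse).1
      have hnum_pos : (1 : ℝ) ≤ binVal (num x.reverse) := by
        have := (hμ x.reverse).2
        rw [List.reverse_reverse] at this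
        rw [this] at hpos
        have := (div_pos_iff_of_pos_right hden_pos).1 hpos
        exact_mod_cast this
      -- A positive fraction has numerator at least 1, so ν(x) exceeds 2 to the minus the length of
      -- its denominator; together with ν(x)/4 ≤ 2^(-n) this bounds `n`.
      have hν_ge : (1 : ℝ) / binVal (den x.reverse) ≤ ν x := by
        have := (hμ x.reverse).2
        rw [List.reverse_reverse] at this
        rw [this]
        gcongr
      have hlt : (binVal (den x.reverse) : ℝ) < 2 ^ (den x.reverse).length := by
        exact_mod_cast binVal_lt _
      have hn_le : n ≤ (den x.reverse).length + 2 := by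
        have h1 : (1 : ℝ) / binVal (den x.reverse) / 4 ≤ ((2 : ℝ) ^ n)⁻¹ :=
          le_trans (by gcongr) hle
        rw [le_inv_comm₀ (by positivity) (by positivity), inv_div, one_div, div_inv_eq_mul] at h1
        have h2 : (2 : ℝ) ^ n < 2 ^ ((den x.reverse).length + 2) := by
          rw [pow_add]
          linarith
        exact ((pow_lt_pow_iff_right₀ one_lt_two).1 h2).le
      have hQx : (den x.reverse).length ≤ Q.eval x.length := by
        simpa [totalLength] using hQ ![x.reverse]
      have hN : p.length + x.length ≤ x.length + 2 + Q.eval x.length := by omega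
      refine (MonotoneTM.time_le hT hn nonneg add_le hne ht).trans ?_
      simp only [Polynomial.eval_mul, Polynomial.eval_comp, Polynomial.eval_add, Polynomial.eval_X,
        Polynomial.eval_ofNat]
      exact Nat.mul_le_mul hN (B.eval_mono_nat hN)
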